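/- Let $L\in\mathbb{R}^{n\times n}$ be a real symmetric positive semi-definite matrix (the Laplacian of a graph with $n$ nodes), with $L=U\,\mathrm{diag}(\lambda_1,\dots,\lambda_n)\,U^\top$, $U$ orthogonal and $\lambda_1\le\dots\le\lambda_n$. Let $1\le k<n$ and let $U_k\in\mathbb{R}^{n\times k}$ consist of the first $k$ columns of $U$. Let $\mathcal N_1,\dots,\mathcal N_N$ be a partition of $\{1,\dots,n\}$ into nonempty groups, let $N^{(\ell)}\in\mathbb{R}^{|\mathcal N_\ell|\times n}$ be the matrix restricting a vector to its entries in $\mathcal N_\ell$, and let $A\in\mathbb{R}^{N\times n}$ be the matrix with rows $|\mathcal N_\ell|^{-1/2}\,\mathbf 1^\top N^{(\ell)}$. Let $p\in\mathbb{R}^N$ be a probability vector with $p_\ell>0$ for all $\ell$, and let $\nu_p:=\max_{1\le \ell\le N}p_\ell^{-1/2}\|N^{(\ell)}U_k\|_2$ (spectral norm). Let $\omega_1,\dots,\omega_s$ be drawn independently from $\{1,\dots,N\}$ with $\mathbb P(\omega_j=\ell)=p_\ell$. Let $M$ be the matrix obtained by stacking $N^{(\omega_1)},\dots,N^{(\omega_s)}$,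 and let $P$ be the diagonal matrix whose entries on the rows of the $j$-th block are all $p_{\omega_j}^{-1/2}$. Let $\widetilde M\in\mathbb{R}^{s\times N}$ have entries $\widetilde M_{ji}=1$ if $i=\omega_j$ and $0$ otherwise, and let $\widetilde P=\mathrm{diag}(p_{\omega_1}^{-1/2},\dots,p_{\omega_s}^{-1/2})$. For $\epsilon\ge 0$ let $$\mathcal A_\epsilon:=\{x\in\mathrm{span}(U_k) : \|(A^\top A-I)x\|_2\le\epsilon\|x\|_2\}.$$ Let $\xi,\delta\in(0,1)$ and suppose that $$s\ \ge\ \frac{3}{\delta^2}\,\nu_p^2\,\log\Big(\frac{2k}{\xi}\Big).$$ Then with probability at least $1-\xi$ the following holds for all constants $M_{\max}>0$ with $\|PM\|_2\le M_{\max}$, all $\epsilon\ge 0$, all $x\in\mathcal A_\epsilon$, all $\tilde n\in\mathbb{R}^s$, all $\gamma>0$, and all real polynomials $g$ that are nonnegative and nondecreasing on $[0,\lambda_n]$ and satisfy $g(\lambda_{k+1})>0$. With $\tilde y=\widetilde M A x+\tilde n$, the problem $$\min_{\tilde z\in\mathbb{R}^N}\ \|\widetilde P(\widetilde M\tilde z-\tilde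 y)\|_2^2+\gamma\,\tilde z^\top A\,g(L)\,A^\top\tilde z$$ has a unique solution $\tilde x^*$, and the vectors $\alpha^*:=U_kU_k^\top A^\top\tilde x^*$ and $\beta^*:=(I-U_kU_k^\top)A^\top\tilde x^*$ satisfy $$\|\alpha^*-x\|_2\le\frac{1}{\sqrt{s(1-\delta)}}\Bigg[\Big(2+\frac{M_{\max}}{\sqrt{\gamma g(\lambda_{k+1})}}\Big)\|\widetilde P\tilde n\|_2+\Big(M_{\max}\sqrt{\frac{g(\lambda_k)}{g(\lambda_{k+1})}}+\sqrt{\gamma g(\lambda_k)}\Big)\|x\|_2+\epsilon\Big(2M_{\max}+M_{\max}\sqrt{\frac{g(\lambda_n)}{g(\lambda_{k+1})}}+\sqrt{\gamma g(\lambda_n)}\Big)\|x\|_2\Bigg]$$ and $$\|\beta^*\|_2\le\frac{1}{\sqrt{\gamma g(\lambda_{k+1})}}\|\widetilde P\tilde n\|_2+\sqrt{\frac{g(\lambda_k)}{g(\lambda_{k+1})}}\,\|x\|_2+\epsilon\,\sqrt{\frac{g(\lambda_n)}{g(\lambda_{k+1})}}\,\|x\|_2 .$$ -/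

import Mathlib

open MeasureTheory ProbabilityTheory
open scoped Matrix

namespace GroupSampling

noncomputable section

/-- Euclidean norm of a real vector (functions `ι → ℝ` carry the sup norm in Mathlib). -/
def norm2 {ι : Type*} [Fintype ι] (v : ι → ℝ) : ℝ := ‖WithLp.toLp 2 v‖

open scoped Matrix.Norms.L2Operator in
/-- Spectral norm of a real matrix: the operator norm for the Euclidean norms. -/
def specNorm {ι κ : Type*} [Fintype ι] [Fintype κ] [DecidableEq κ] (X : Matrix ι κ ℝ) : ℝ := ‖X‖

/-- `L = U diag(lam) Uᵀ` with orthonormal eigenvectors (the columns of `U`) ordered by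
nondecreasing eigenvalue. -/
structure IsFourierBasis {n : ℕ} (L U : Matrix (Fin n) (Fin n) ℝ) (lam : Fin n → ℝ) : Prop where
  mono : Monotone lam
  orthonormal : Uᵀ * U = 1
  eigen : L = U * Matrix.diagonal lam * Uᵀ

/-- The matrix `U_k` of the first `k` columns of `U`. -/
def firstCols {n : ℕ} (U : Matrix (Fin n) (Fin n) ℝ) {k : ℕ} (hk : k ≤ n) :
    Matrix (Fin n) (Fin k) ℝ :=
  U.submatrix id (Fin.castLE hk)

/-- The groups form a partition of the nodes into nonempty sets. -/
structure IsPartition {n N : ℕ} (G : Fin N → Finset (Fin n)) : Prop where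
  nonempty : ∀ l, (G l).Nonempty
  disjoint : ∀ l l', l ≠ l' → Disjoint (G l) (G l')
  cover : ∀ i, ∃ l, i ∈ G l

/-- The matrix `N^(l)` that restricts a signal to the nodes of group `l`
(its rows are indexed by the nodes of the group). -/
def groupMat {n N : ℕ} (G : Fin N → Finset (Fin n)) (l : Fin N) : Matrix (G l) (Fin n) ℝ :=
  Matrix.of fun r i => if i = (r : Fin n) then 1 else 0

/-- The averaging matrix `A`, whose `l`-th row is `1ᵀ N^(l) / |N_l|^(1/2)`. -/
def avgMat {n N : ℕ} (G : Fin N → Finset (Fin n)) : Matrix (Fin N) (Fin n) ℝ :=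
  Matrix.of fun l i => ((1 : G l → ℝ) ᵥ* groupMat G l) i / √((G l).card : ℝ)

/-- Group graph cumulative coherence `max_l p_l^(-1/2) ‖N^(l) U_k‖₂`. -/
def coherence {n N k : ℕ} (G : Fin N → Finset (Fin n)) (p : Fin N → ℝ)
    (Uk : Matrix (Fin n) (Fin k) ℝ) : ℝ :=
  ⨆ l, (√(p l))⁻¹ * specNorm (groupMat G l * Uk)

/-- Row index of the sampling matrix of a draw `ω` of `s` groups: a position `j` of the draw
together with a node of the group `ω j`. It has `m = ∑ j, |N_(ω j)|` elements. -/
abbrev SampleIdx {n N s : ℕ} (G : Fin N → Finset (Fin n)) (ω : Fin s → Fin N) : Type :=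
  Σ j : Fin s, G (ω j)

/-- The sampling matrix `M`: the matrices `N^(ω 1), …, N^(ω s)` stacked. -/
def sampleMat {n N s : ℕ} (G : Fin N → Finset (Fin n)) (ω : Fin s → Fin N) :
    Matrix (SampleIdx G ω) (Fin n) ℝ :=
  Matrix.of fun r i => groupMat G (ω r.1) r.2 i

/-- The diagonal weight matrix `P`, with entry `p_(ω j)^(-1/2)` on the block of the `j`-th draw. -/
def weightMat {n N s : ℕ} (G : Fin N → Finset (Fin n)) (p : Fin N → ℝ) (ω : Fin s → Fin N) :
    Matrix (SampleIdx G ω) (SampleIdx G ω) ℝ :=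
  Matrix.diagonal fun r => (√(p (ω r.1)))⁻¹

/-- The reduced sampling matrix `M̃`. -/
def redSampleMat {N s : ℕ} (ω : Fin s → Fin N) : Matrix (Fin s) (Fin N) ℝ :=
  Matrix.of fun j i => if i = ω j then 1 else 0

/-- The reduced diagonal weight matrix `P̃`. -/
def redWeightMat {N s : ℕ} (p : Fin N → ℝ) (ω : Fin s → Fin N) : Matrix (Fin s) (Fin s) ℝ :=
  Matrix.diagonal fun j => (√(p (ω j)))⁻¹

/-- The signal model: `x` in `span(U_k)` with `‖(AᵀA - I) x‖₂ ≤ ε ‖x‖₂`. -/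
def nearlyPiecewiseConst {n N k : ℕ} (G : Fin N → Finset (Fin n))
    (Uk : Matrix (Fin n) (Fin k) ℝ) (ε : ℝ) : Set (Fin n → ℝ) :=
  {x | (∃ η : Fin k → ℝ, x = Uk *ᵥ η) ∧
    norm2 (((avgMat G)ᵀ * avgMat G - 1) *ᵥ x) ≤ ε * norm2 x}

/-- The reduced regularisation matrix `A g(L) Aᵀ`. -/
def redLaplacian {n N : ℕ} (G : Fin N → Finset (Fin n)) (L : Matrix (Fin n) (Fin n) ℝ)
    (g : Polynomial ℝ) : Matrix (Fin N) (Fin N) ℝ :=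
  avgMat G * Polynomial.aeval L g * (avgMat G)ᵀ

/-- The objective `‖P̃ (M̃ z - y)‖₂² + γ zᵀ A g(L) Aᵀ z` of the reduced decoder. -/
def fastObjective {n N s : ℕ} (G : Fin N → Finset (Fin n)) (L : Matrix (Fin n) (Fin n) ℝ)
    (p : Fin N → ℝ) (ω : Fin s → Fin N) (γ : ℝ) (g : Polynomial ℝ) (y : Fin s → ℝ)
    (z : Fin N → ℝ) : ℝ :=
  norm2 (redWeightMat p ω *ᵥ (redSampleMat ω *ᵥ z - y)) ^ 2
    + γ * (z ⬝ᵥ (redLaplacian G L g *ᵥ z))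

/-- `z` is a global minimiser of the objective of the reduced decoder. -/
def IsFastSolution {n N s : ℕ} (G : Fin N → Finset (Fin n)) (L : Matrix (Fin n) (Fin n) ℝ)
    (p : Fin N → ℝ) (ω : Fin s → Fin N) (γ : ℝ) (g : Polynomial ℝ) (y : Fin s → ℝ)
    (z : Fin N → ℝ) : Prop :=
  ∀ z' : Fin N → ℝ, fastObjective G L p ω γ g y z ≤ fastObjective G L p ω γ g y z'

end

end GroupSampling

open GroupSampling

/-! Everything rests on one event: the lower restricted isometry `s(1-δ)‖x‖² ≤ ‖PMx‖²` on
`span(U_k)`. On it the bounds are deterministic, so they hold for all signals, noises and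
regularisers at once.

Probability. The matrices `X_l = p_l⁻¹ (N^(l) U_k)ᵀ (N^(l) U_k)` have mean `1` (the groups partition
the nodes, `U_k` has orthonormal columns) and quadratic forms at most `ν_p²` on unit vectors. A
matrix Chernoff lower tail bounds the failure probability by `k exp(-sδ²/(2ν_p²))`. It follows from
the trace-exponential method: Golden–Thompson peels off one draw at a time. Golden–Thompson comes
from the Lie–Trotter formula and `tr (PQ)^(2^m) ≤ tr P^(2^m) Q^(2^m)`.

Stability. Since `Aᵀz` is constant on groups, `‖PMAᵀz‖ = ‖P̃M̃z‖`, so the isometry also controls the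
reduced problem. Comparing the minimiser `z` with the competitor `Ax`, whose residual is pure noise,
bounds both the residual and the penalty of `z`. The penalty controls the high-frequency part `β`;
the isometry applied to `α - x = Aᵀ(z - Ax) + e - β`, with `e = (AᵀA - I)x`, controls the rest. -/

namespace GroupSampling

open Filter Topology NormedSpace

/-! ### Lie–Trotter product formula. -/

section Trotter

variable {𝔸 : Type*} [NormedRing 𝔸] [NormOneClass 𝔸]

theorem norm_pow_sub_pow_le {x y : 𝔸} {C : ℝ} (hx : ‖x‖ ≤ C) (hy : ‖y‖ ≤ C) (n : ℕ) :
    ‖x ^ (n + 1) - y ^ (n + 1)‖ ≤ (n + 1) * C ^ n * ‖x - y‖ := by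
  have hC : 0 ≤ C := (norm_nonneg x).trans hx
  induction n with
  | zero => simp
  | succ n ih =>
    have h : x ^ (n + 1 + 1) - y ^ (n + 1 + 1)
        = x ^ (n + 1) * (x - y) + (x ^ (n + 1) - y ^ (n + 1)) * y := by
      rw [pow_succ x (n + 1), pow_succ y (n + 1)]; noncomm_ring
    rw [h]
    calc _ ≤ ‖x ^ (n + 1)‖ * ‖x - y‖ + ‖x ^ (n + 1) - y ^ (n + 1)‖ * ‖y‖ :=
          (norm_add_le _ _).trans (add_le_add (norm_mul_le _ _) (norm_mul_le _ _))
      _ ≤ C ^ (n + 1) * ‖x - y‖ + ((n + 1) * C ^ n * ‖x - y‖) * C := by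
          gcongr
          exact (norm_pow_le x (n + 1)).trans (by gcongr)
      _ = _ := by push_cast; ring

variable [NormedAlgebra ℝ 𝔸]

theorem norm_exp_le_exp_norm (x : 𝔸) : ‖exp x‖ ≤ Real.exp ‖x‖ := by
  have h1 : Summable fun n : ℕ => ‖((n.factorial : ℝ)⁻¹) • x ^ n‖ := norm_expSeries_summable' x
  have h2 : HasSum (fun n : ℕ => ((n.factorial : ℝ)⁻¹) • ‖x‖ ^ n) (Real.exp ‖x‖) := by
    rw [Real.exp_eq_exp_ℝ]; exact exp_series_hasSum_exp' ‖x‖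
  rw [exp_eq_tsum ℝ]
  refine (norm_tsum_le_tsum_norm h1).trans ?_
  rw [← h2.tsum_eq]
  refine h1.tsum_le_tsum (fun n => ?_) h2.summable
  rw [norm_smul, smul_eq_mul, norm_inv, Real.norm_natCast]
  gcongr
  exact norm_pow_le x n

/-- The **Lie–Trotter product formula** in a Banach algebra. -/
theorem tendsto_exp_mul_exp_pow [CompleteSpace 𝔸] (a b : 𝔸) :
    Tendsto (fun n : ℕ => (exp ((n : ℝ)⁻¹ • a) * exp ((n : ℝ)⁻¹ • b)) ^ n) atTop
      (𝓝 (exp (a + b))) := by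
  -- The product of exponentials and the exponential of the sum agree to first order at `0`, so
  -- their difference at `t = 1/(n+1)` is `o(t)`. Telescoping the powers multiplies it by `n+1` and
  -- a bounded factor, and it still vanishes.
  have hder : HasDerivAt
      (fun t : ℝ => exp (t • a) * exp (t • b) - exp (t • (a + b))) 0 0 := by
    have h := ((hasDerivAt_exp_smul_const a (0 : ℝ)).mul
      (hasDerivAt_exp_smul_const b (0 : ℝ))).sub (hasDerivAt_exp_smul_const (a + b) (0 : ℝ))
    convert! h using 1
    simp
  have hinv : Tendsto (fun n : ℕ => ((n : ℝ) + 1)⁻¹) atTop (𝓝[≠] 0) := by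
    refine tendsto_nhdsWithin_iff.2 ⟨?_, .of_forall fun n => ?_⟩
    · simpa using tendsto_one_div_add_atTop_nhds_zero_nat (𝕜 := ℝ)
    · exact inv_ne_zero (by positivity)
  have hslope := (hasDerivAt_iff_tendsto_slope.1 hder).comp hinv
  rw [← tendsto_add_atTop_iff_nat 1, tendsto_iff_norm_sub_tendsto_zero]
  set K : ℝ := ‖a‖ + ‖b‖ with hK
  have hbound : Tendsto (fun n : ℕ => Real.exp K * ‖slope (fun t : ℝ => exp (t • a) * exp (t • b)
      - exp (t • (a + b))) 0 ((n : ℝ) + 1)⁻¹‖) atTop (𝓝 0) := by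
    simpa using (hslope.norm.const_mul (Real.exp K))
  refine squeeze_zero (fun _ => norm_nonneg _) (fun n => ?_) hbound
  have hn : (0 : ℝ) < (n : ℝ) + 1 := by positivity
  push_cast
  set t : ℝ := ((n : ℝ) + 1)⁻¹ with ht
  have ht0 : 0 < t := inv_pos.2 hn
  have hexp : exp (a + b) = exp (t • (a + b)) ^ (n + 1) := by
    let : NormedAlgebra ℚ 𝔸 := .restrictScalars ℚ ℝ 𝔸
    rw [← exp_nsmul, ← Nat.cast_smul_eq_nsmul ℝ, smul_smul]
    push_cast
    rw [ht, mul_inv_cancel₀ hn.ne', one_smul]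
  have hn1 : ∀ c : 𝔸, ‖t • c‖ = t * ‖c‖ := fun c => by
    rw [norm_smul, Real.norm_of_nonneg ht0.le]
  have h1 : ‖exp (t • a) * exp (t • b)‖ ≤ Real.exp (t * K) := by
    refine (norm_mul_le _ _).trans ?_
    rw [hK, mul_add, Real.exp_add, ← hn1, ← hn1]
    gcongr <;> exact norm_exp_le_exp_norm _
  have h2 : ‖exp (t • (a + b))‖ ≤ Real.exp (t * K) := by
    refine (norm_exp_le_exp_norm _).trans ?_
    rw [hn1, hK]
    gcongr
    exact norm_add_le _ _
  rw [hexp]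
  refine (norm_pow_sub_pow_le h1 h2 n).trans ?_
  have h3 : Real.exp (t * K) ^ n ≤ Real.exp K := by
    rw [← Real.exp_nat_mul]
    refine Real.exp_le_exp.2 ?_
    have : (n : ℝ) * t ≤ 1 := by
      rw [ht, ← div_eq_mul_inv, div_le_one hn]; linarith
    have hK0 : 0 ≤ K := by positivity
    calc (n : ℝ) * (t * K) = (n * t) * K := by ring
      _ ≤ 1 * K := by gcongr
      _ = K := one_mul K
  have h4 : ‖slope (fun t : ℝ => exp (t • a) * exp (t • b) - exp (t • (a + b))) 0 t‖
      = (n + 1) * ‖exp (t • a) * exp (t • b) - exp (t • (a + b))‖ := by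
    rw [slope_def_module, norm_smul]
    simp [ht, abs_of_pos hn]
  rw [h4]
  calc _ ≤ ((n : ℝ) + 1) * Real.exp K * ‖exp (t • a) * exp (t • b) - exp (t • (a + b))‖ := by
        gcongr
    _ = _ := by ring

end Trotter

/-! ### Golden–Thompson inequality. -/

section GoldenThompson

variable {n : Type*} [Fintype n] [DecidableEq n]

theorem trace_mul_pow_comm (X Y : Matrix n n ℝ) (m : ℕ) :
    ((X * Y) ^ m).trace = ((Y * X) ^ m).trace := by
  cases m with
  | zero => simp
  | succ m =>
    have h : (X * Y) ^ (m + 1) = X * ((Y * X) ^ m * Y) := by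
      induction m with
      | zero => simp
      | succ m ih => rw [pow_succ, ih, pow_succ (Y * X)]; simp only [Matrix.mul_assoc]
    rw [h, Matrix.trace_mul_comm, pow_succ, Matrix.mul_assoc]

theorem abs_trace_sq_le (M : Matrix n n ℝ) : |(M ^ 2).trace| ≤ (M * Mᵀ).trace := by
  have h : (M * Mᵀ).trace = ∑ i, ∑ j, (M i j ^ 2 + M j i ^ 2) / 2 := by
    simp only [Matrix.trace, Matrix.diag, Matrix.mul_apply, Matrix.transpose_apply]
    have : ∑ i, ∑ j, M j i ^ 2 = ∑ i, ∑ j, M i j ^ 2 := Finset.sum_comm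
    simp only [← Finset.sum_div, Finset.sum_add_distrib, this, ← sq]
    ring
  rw [h, pow_two]
  simp only [Matrix.trace, Matrix.diag, Matrix.mul_apply]
  refine (Finset.abs_sum_le_sum_abs _ _).trans (Finset.sum_le_sum fun i _ => ?_)
  refine (Finset.abs_sum_le_sum_abs _ _).trans (Finset.sum_le_sum fun j _ => ?_)
  rw [abs_le]
  constructor <;> nlinarith [sq_nonneg (M i j - M j i), sq_nonneg (M i j + M j i)]

theorem trace_mul_le_of_isSymm {P Q : Matrix n n ℝ} (hP : P.IsSymm) (hQ : Q.IsSymm) :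
    (P * Q).trace ≤ ((P ^ 2).trace + (Q ^ 2).trace) / 2 := by
  have h : 0 ≤ ((P - Q)ᵀ * (P - Q)).trace := by
    have := (Matrix.posSemidef_conjTranspose_mul_self (P - Q)).trace_nonneg
    rwa [Matrix.conjTranspose_eq_transpose_of_trivial] at this
  rw [Matrix.transpose_sub, hP.eq, hQ.eq] at h
  have h2 : (P - Q) * (P - Q) = P ^ 2 + Q ^ 2 - P * Q - Q * P := by noncomm_ring
  rw [h2, Matrix.trace_sub, Matrix.trace_sub, Matrix.trace_add, Matrix.trace_mul_comm Q P] at h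
  linarith

/-- The two claims feed each other. The first at `m+1` applies the first at `m` to `M ^ 2`, cycles
the trace, uses the second on `Mᵀ * M` and `M * Mᵀ`, and ends with `2 tr PQ ≤ tr P² + tr Q²`. The
second at `m+1` applies the first at `m` to `P * Q`, then the second to the squares. -/
theorem trace_pow_two_pow_le (m : ℕ) :
    (∀ M : Matrix n n ℝ, |(M ^ 2 ^ (m + 1)).trace| ≤ ((M * Mᵀ) ^ 2 ^ m).trace) ∧
    (∀ P Q : Matrix n n ℝ, P.IsSymm → Q.IsSymm →
      ((P * Q) ^ 2 ^ m).trace ≤ (P ^ 2 ^ m * Q ^ 2 ^ m).trace) := by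
  induction m with
  | zero => exact ⟨fun M => by simpa using abs_trace_sq_le M, fun P Q _ _ => by simp⟩
  | succ m ih =>
    obtain ⟨iha, ihb⟩ := ih
    constructor
    · intro M
      have hs1 : (Mᵀ * M).IsSymm := by simp [Matrix.IsSymm, Matrix.transpose_mul]
      have hs2 : (M * Mᵀ).IsSymm := by simp [Matrix.IsSymm, Matrix.transpose_mul]
      calc |(M ^ 2 ^ (m + 1 + 1)).trace| = |((M ^ 2) ^ 2 ^ (m + 1)).trace| := by
            rw [← pow_mul, pow_succ' 2 (m + 1)]
        _ ≤ ((M ^ 2 * (M ^ 2)ᵀ) ^ 2 ^ m).trace := iha _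
        _ = (((M * (M * Mᵀ)) * Mᵀ) ^ 2 ^ m).trace := by
            rw [pow_two, Matrix.transpose_mul]; simp only [Matrix.mul_assoc]
        _ = (((Mᵀ * M) * (M * Mᵀ)) ^ 2 ^ m).trace := by
            rw [trace_mul_pow_comm]; simp only [Matrix.mul_assoc]
        _ ≤ ((Mᵀ * M) ^ 2 ^ m * (M * Mᵀ) ^ 2 ^ m).trace := ihb _ _ hs1 hs2
        _ ≤ ((((Mᵀ * M) ^ 2 ^ m) ^ 2).trace + (((M * Mᵀ) ^ 2 ^ m) ^ 2).trace) / 2 :=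
            trace_mul_le_of_isSymm (hs1.pow _) (hs2.pow _)
        _ = ((M * Mᵀ) ^ 2 ^ (m + 1)).trace := by
            rw [← pow_mul, ← pow_mul, ← pow_succ, trace_mul_pow_comm Mᵀ M]; ring
    · intro P Q hP hQ
      calc ((P * Q) ^ 2 ^ (m + 1)).trace ≤ (((P * Q) * (P * Q)ᵀ) ^ 2 ^ m).trace :=
            (le_abs_self _).trans (iha _)
        _ = (((P * Q ^ 2) * P) ^ 2 ^ m).trace := by
            rw [Matrix.transpose_mul, hP.eq, hQ.eq, pow_two]; simp only [Matrix.mul_assoc]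
        _ = ((P ^ 2 * Q ^ 2) ^ 2 ^ m).trace := by
            rw [trace_mul_pow_comm, pow_two P]; simp only [Matrix.mul_assoc]
        _ ≤ ((P ^ 2) ^ 2 ^ m * (Q ^ 2) ^ 2 ^ m).trace := ihb _ _ (hP.pow _) (hQ.pow _)
        _ = _ := by rw [← pow_mul, ← pow_mul, ← pow_succ']

open scoped Matrix.Norms.L2Operator in
/-- The **Golden–Thompson inequality** for real symmetric matrices. -/
theorem trace_exp_add_le [Nonempty n] {A B : Matrix n n ℝ} (hA : A.IsSymm) (hB : B.IsSymm) :
    (exp (A + B)).trace ≤ (exp A * exp B).trace := by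
  -- The trace inequality covers exponents `2 ^ m` only, so the limit runs along that subsequence.
  have hlim : Tendsto (fun m : ℕ => ((exp (((2 ^ m : ℕ) : ℝ)⁻¹ • A)
      * exp (((2 ^ m : ℕ) : ℝ)⁻¹ • B)) ^ 2 ^ m).trace) atTop (𝓝 (exp (A + B)).trace) :=
    (continuous_id.matrix_trace.tendsto _).comp
      ((tendsto_exp_mul_exp_pow A B).comp (tendsto_pow_atTop_atTop_of_one_lt one_lt_two))
  refine le_of_tendsto hlim (.of_forall fun m => ?_)
  have hpow : ∀ C : Matrix n n ℝ, exp (((2 ^ m : ℕ) : ℝ)⁻¹ • C) ^ 2 ^ m = exp C := fun C => by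
    rw [← Matrix.exp_nsmul, ← Nat.cast_smul_eq_nsmul ℝ, smul_smul, mul_inv_cancel₀ (by positivity),
      one_smul]
  refine ((trace_pow_two_pow_le m).2 _ _ (hA.smul _).exp (hB.smul _).exp).trans ?_
  rw [hpow, hpow]

end GoldenThompson

/-! ### Matrix Chernoff bound, lower tail. -/

section Chernoff

open NormedSpace Matrix

variable {n : Type*} [Fintype n] [DecidableEq n]

theorem exists_orthogonal_diagonalization {A : Matrix n n ℝ} (hA : A.IsSymm) :
    ∃ (U : Matrix n n ℝ) (d : n → ℝ), Uᵀ * U = 1 ∧ U * Uᵀ = 1 ∧ A = U * diagonal d * Uᵀ := by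
  have hH : A.IsHermitian := by rwa [Matrix.IsHermitian, conjTranspose_eq_transpose_of_trivial]
  have h1 : (hH.eigenvectorUnitary : Matrix n n ℝ)ᵀ * hH.eigenvectorUnitary = 1 := by
    have := Unitary.coe_star_mul_self hH.eigenvectorUnitary
    rwa [star_eq_conjTranspose, conjTranspose_eq_transpose_of_trivial] at this
  refine ⟨hH.eigenvectorUnitary, hH.eigenvalues, h1, _root_.mul_eq_one_comm.1 h1, ?_⟩
  have := hH.spectral_theorem
  rw [Unitary.conjStarAlgAut_apply, star_eq_conjTranspose,
    conjTranspose_eq_transpose_of_trivial] at this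
  exact this

theorem exp_orthogonal_conj {U : Matrix n n ℝ} (hU : Uᵀ * U = 1) (d : n → ℝ) :
    exp (U * diagonal d * Uᵀ) = U * diagonal (fun i => Real.exp (d i)) * Uᵀ := by
  have hinv : U⁻¹ = Uᵀ := Matrix.inv_eq_left_inv hU
  have hu : IsUnit U := (isUnit_iff_isUnit_det U).2 (isUnit_det_of_left_inverse hU)
  rw [← hinv, Matrix.exp_conj U _ hu, Matrix.exp_diagonal]
  congr 3
  ext i
  rw [Pi.coe_exp, Real.exp_eq_exp_ℝ]

theorem dotProduct_mulVec_orthogonal_conj (U : Matrix n n ℝ) (d : n → ℝ) (v : n → ℝ) :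
    v ⬝ᵥ ((U * diagonal d * Uᵀ) *ᵥ v) = ∑ i, d i * (Uᵀ *ᵥ v) i ^ 2 := by
  rw [← mulVec_mulVec, ← mulVec_mulVec, dotProduct_mulVec, ← mulVec_transpose]
  simp only [dotProduct, mulVec_diagonal]
  exact Finset.sum_congr rfl fun i _ => by ring

theorem sum_sq_transpose_mulVec {U : Matrix n n ℝ} (hU : U * Uᵀ = 1) (v : n → ℝ) :
    ∑ i, (Uᵀ *ᵥ v) i ^ 2 = v ⬝ᵥ v := by
  have h := dotProduct_mulVec_orthogonal_conj U 1 v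
  simpa [hU] using h.symm

/-- In an eigenbasis `v ⬝ᵥ (S *ᵥ v)` is a weighted mean of eigenvalues, so some eigenvalue is at
least as large, and its exponential is one term of the trace. -/
theorem exp_dotProduct_le_trace_exp {S : Matrix n n ℝ} (hS : S.IsSymm) {v : n → ℝ}
    (hv : v ⬝ᵥ v = 1) : Real.exp (v ⬝ᵥ (S *ᵥ v)) ≤ (exp S).trace := by
  obtain ⟨U, d, h1, h2, rfl⟩ := exists_orthogonal_diagonalization hS
  rw [exp_orthogonal_conj h1, trace_mul_comm, ← Matrix.mul_assoc, h1, Matrix.one_mul,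
    trace_diagonal, dotProduct_mulVec_orthogonal_conj]
  have hw : ∑ i, (Uᵀ *ᵥ v) i ^ 2 = 1 := by rw [sum_sq_transpose_mulVec h2, hv]
  obtain ⟨i, -, hi⟩ : ∃ i ∈ Finset.univ, ∑ i, d i * (Uᵀ *ᵥ v) i ^ 2 ≤ d i := by
    by_contra! hcon
    set c := ∑ i, d i * (Uᵀ *ᵥ v) i ^ 2 with hc
    have h3 : ∑ i, c * (Uᵀ *ᵥ v) i ^ 2 ≤ c := by rw [← Finset.mul_sum, hw, mul_one]
    have h4 : ∃ i ∈ Finset.univ, (Uᵀ *ᵥ v) i ^ 2 ≠ 0 := by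
      by_contra! h0
      rw [Finset.sum_eq_zero h0] at hw
      exact zero_ne_one hw
    obtain ⟨i, hi, hi0⟩ := h4
    refine absurd h3 (not_le.2 ?_)
    conv_lhs => rw [hc]
    refine Finset.sum_lt_sum (fun j hj => ?_) ⟨i, hi, ?_⟩
    · exact mul_le_mul_of_nonneg_right (hcon j hj).le (sq_nonneg _)
    · exact mul_lt_mul_of_pos_right (hcon i hi) (lt_of_le_of_ne (sq_nonneg _) hi0.symm)
  exact (Real.exp_le_exp.2 hi).trans
    (Finset.single_le_sum (f := fun i => Real.exp (d i)) (fun j _ => (Real.exp_pos _).le)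
      (Finset.mem_univ i))

theorem trace_mul_nonneg_of_posSemidef {P Q : Matrix n n ℝ} (hP : P.PosSemidef)
    (hQ : Q.PosSemidef) : 0 ≤ (P * Q).trace := by
  obtain ⟨U, d, h1, h2, h3⟩ := exists_orthogonal_diagonalization (A := P)
    (by have := hP.1; rwa [Matrix.IsHermitian, conjTranspose_eq_transpose_of_trivial] at this)
  have hd : ∀ i, 0 ≤ d i := by
    have h4 : diagonal d = Uᴴ * P * U := by
      rw [h3, conjTranspose_eq_transpose_of_trivial]
      calc diagonal d = (Uᵀ * U) * diagonal d * (Uᵀ * U) := by rw [h1]; simp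
        _ = _ := by simp only [Matrix.mul_assoc]
    have h5 := hP.conjTranspose_mul_mul_same U
    rw [← h4] at h5
    exact fun i => posSemidef_diagonal_iff.1 h5 i
  have h6 := hQ.conjTranspose_mul_mul_same U
  rw [conjTranspose_eq_transpose_of_trivial] at h6
  have h7 : (P * Q).trace = ∑ i, d i * (Uᵀ * Q * U) i i := by
    rw [h3, Matrix.mul_assoc, Matrix.mul_assoc, trace_mul_comm, Matrix.mul_assoc]
    simp [trace, diagonal_mul, Matrix.mul_assoc]
  rw [h7]
  exact Finset.sum_nonneg fun i _ => mul_nonneg (hd i) h6.diag_nonneg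

theorem posSemidef_exp {S : Matrix n n ℝ} (hS : S.IsSymm) : (exp S).PosSemidef := by
  obtain ⟨U, d, h1, -, rfl⟩ := exists_orthogonal_diagonalization hS
  rw [exp_orthogonal_conj h1, ← conjTranspose_eq_transpose_of_trivial]
  exact PosSemidef.mul_mul_conjTranspose_same
    (PosSemidef.diagonal fun i => (Real.exp_pos _).le) U

/-- Invert `exp y ≥ 1 + y + y²/2` and use `(1 + y + y²/2)(1 - y + y²/2) = 1 + y⁴/4`. -/
theorem exp_neg_le_quadratic {y : ℝ} (hy : 0 ≤ y) : Real.exp (-y) ≤ 1 - y + y ^ 2 / 2 := by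
  have h := Real.quadratic_le_exp_of_nonneg hy
  have hq : 0 < 1 + y + y ^ 2 / 2 := by positivity
  rw [Real.exp_neg]
  refine (inv_anti₀ hq h).trans ?_
  rw [inv_le_iff_one_le_mul₀ hq]
  nlinarith [sq_nonneg (y ^ 2)]

/-- Eigenvalues `d` lie in `[0, R]`, so `d² ≤ R d` makes the quadratic bound on `exp (-θ d)` linear
in `d`. Linearity in `X` is what allows averaging over draws. -/
theorem posSemidef_sub_exp_neg_smul {X : Matrix n n ℝ} (hX : X.PosSemidef) {R θ : ℝ}
    (hθ : 0 ≤ θ) (hR : ∀ v, v ⬝ᵥ (X *ᵥ v) ≤ R * (v ⬝ᵥ v)) :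
    (1 - (θ - θ ^ 2 * R / 2) • X - exp (-θ • X)).PosSemidef := by
  have hs : X.IsSymm := by
    have := hX.1; rwa [Matrix.IsHermitian, conjTranspose_eq_transpose_of_trivial] at this
  obtain ⟨U, d, h1, h2, rfl⟩ := exists_orthogonal_diagonalization hs
  have hentry : ∀ i, (U *ᵥ Pi.single i 1) ⬝ᵥ ((U * diagonal d * Uᵀ) *ᵥ (U *ᵥ Pi.single i 1))
      = d i := fun i => by
    rw [dotProduct_mulVec_orthogonal_conj, mulVec_mulVec, h1, one_mulVec,
      Finset.sum_eq_single i] <;> simp +contextual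
  have hunit : ∀ i, (U *ᵥ Pi.single i 1) ⬝ᵥ (U *ᵥ (Pi.single i 1 : n → ℝ)) = 1 := fun i => by
    rw [← sum_sq_transpose_mulVec h2, mulVec_mulVec, h1, one_mulVec,
      Finset.sum_eq_single i] <;> simp +contextual
  have hd0 : ∀ i, 0 ≤ d i := fun i => by
    rw [← hentry i]; exact hX.dotProduct_mulVec_nonneg _
  have hdR : ∀ i, d i ≤ R := fun i => by
    have := hR (U *ᵥ Pi.single i 1); rwa [hentry, hunit, mul_one] at this
  have h3 : -θ • (U * diagonal d * Uᵀ) = U * diagonal (-θ • d) * Uᵀ := by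
    rw [diagonal_smul, Matrix.mul_smul, Matrix.smul_mul]
  have h4 : 1 - (θ - θ ^ 2 * R / 2) • (U * diagonal d * Uᵀ) - exp (-θ • (U * diagonal d * Uᵀ))
      = U * diagonal (fun i => 1 - (θ - θ ^ 2 * R / 2) * d i - Real.exp (-θ * d i)) * Uᴴ := by
    rw [h3, exp_orthogonal_conj h1, conjTranspose_eq_transpose_of_trivial]
    have : diagonal (fun i => 1 - (θ - θ ^ 2 * R / 2) * d i - Real.exp (-θ * d i))
        = 1 - (θ - θ ^ 2 * R / 2) • diagonal d - diagonal (fun i => Real.exp ((-θ • d) i)) := by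
      rw [← diagonal_smul, ← diagonal_one, diagonal_sub, diagonal_sub]; rfl
    rw [this, Matrix.mul_sub, Matrix.mul_sub, Matrix.sub_mul, Matrix.sub_mul]
    simp [h2]
  rw [h4]
  refine PosSemidef.mul_mul_conjTranspose_same (PosSemidef.diagonal fun i => ?_) U
  have h5 := exp_neg_le_quadratic (mul_nonneg hθ (hd0 i))
  have h6 : θ ^ 2 * d i * d i ≤ θ ^ 2 * d i * R :=
    mul_le_mul_of_nonneg_left (hdR i) (mul_nonneg (sq_nonneg _) (hd0 i))
  rw [← neg_mul] at h5
  simp only [Pi.zero_apply]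
  nlinarith

variable {ι : Type*} [Fintype ι]

theorem isSymm_sum {m κ : Type*} (t : Finset κ) {Y : κ → Matrix m m ℝ} (hY : ∀ l, (Y l).IsSymm) :
    (∑ j ∈ t, Y j).IsSymm := by
  rw [Matrix.IsSymm, transpose_sum]
  exact Finset.sum_congr rfl fun l _ => hY l

/-- Golden–Thompson separates the first draw from the others. By independence its exponential can be
averaged alone, and the trace against a positive semidefinite matrix is monotone, so each draw costs
a factor `c`. -/
theorem sum_prod_trace_exp_sum_le [Nonempty n] {p : ι → ℝ} (hp : ∀ l, 0 ≤ p l)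
    {Y : ι → Matrix n n ℝ} (hY : ∀ l, (Y l).IsSymm) {c : ℝ} (hc : 0 ≤ c)
    (hle : (c • (1 : Matrix n n ℝ) - ∑ l, p l • exp (Y l)).PosSemidef) (s : ℕ) :
    ∑ f : Fin s → ι, (∏ j, p (f j)) * (exp (∑ j, Y (f j))).trace ≤ c ^ s * Fintype.card n := by
  induction s with
  | zero => simp
  | succ s ih =>
    rw [← (Fin.consEquiv fun _ => ι).sum_comp, Fintype.sum_prod_type_right]
    calc _ ≤ ∑ f : Fin s → ι, (∏ j, p (f j)) * (c * (exp (∑ j, Y (f j))).trace) := by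
          refine Finset.sum_le_sum fun f _ => ?_
          have hsum : (∑ j, Y (f j)).IsSymm := isSymm_sum _ fun j => hY (f j)
          simp only [Fin.consEquiv_apply, Fin.prod_univ_succ, Fin.sum_univ_succ, Fin.cons_zero,
            Fin.cons_succ]
          calc _ ≤ ∑ l, p l * (∏ j, p (f j)) * (exp (Y l) * exp (∑ j, Y (f j))).trace := by
                refine Finset.sum_le_sum fun l _ => ?_
                exact mul_le_mul_of_nonneg_left (trace_exp_add_le (hY l) hsum)
                  (mul_nonneg (hp l) (Finset.prod_nonneg fun j _ => hp (f j)))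
            _ = (∏ j, p (f j)) * ((∑ l, p l • exp (Y l)) * exp (∑ j, Y (f j))).trace := by
                rw [Finset.sum_mul, trace_sum, Finset.mul_sum]
                refine Finset.sum_congr rfl fun l _ => ?_
                rw [smul_mul_assoc, trace_smul, smul_eq_mul]; ring
            _ ≤ _ := by
                refine mul_le_mul_of_nonneg_left ?_ (Finset.prod_nonneg fun j _ => hp (f j))
                have := trace_mul_nonneg_of_posSemidef hle (posSemidef_exp hsum)
                rw [Matrix.sub_mul, trace_sub, smul_mul_assoc, Matrix.one_mul, trace_smul,
                  smul_eq_mul] at this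
                linarith
      _ = c * ∑ f : Fin s → ι, (∏ j, p (f j)) * (exp (∑ j, Y (f j))).trace := by
          rw [Finset.mul_sum]
          exact Finset.sum_congr rfl fun f _ => by ring
      _ ≤ c * (c ^ s * Fintype.card n) := mul_le_mul_of_nonneg_left ih hc
      _ = _ := by ring

open scoped Classical in
/-- Lower tail of the **matrix Chernoff bound**, for independent draws from a finite
distribution on positive semidefinite matrices with mean the identity. -/
theorem matrix_chernoff_lower_tail [Nonempty n] {p : ι → ℝ} (hp : ∀ l, 0 ≤ p l)
    (hp1 : ∑ l, p l = 1) {X : ι → Matrix n n ℝ} (hX : ∀ l, (X l).PosSemidef)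
    (hmean : ∑ l, p l • X l = 1) {R : ℝ} (hR : 0 < R)
    (hbound : ∀ l v, v ⬝ᵥ (X l *ᵥ v) ≤ R * (v ⬝ᵥ v)) {δ : ℝ} (hδ : 0 ≤ δ) (s : ℕ) :
    ∑ f : Fin s → ι with ∃ v : n → ℝ, v ⬝ᵥ v = 1 ∧ v ⬝ᵥ ((∑ j, X (f j)) *ᵥ v) < (1 - δ) * s,
        ∏ j, p (f j) ≤ Fintype.card n * Real.exp (-(s * δ ^ 2 / (2 * R))) := by
  -- This choice minimises the final exponent `s(-θδ + θ²R/2)`.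
  set θ := δ / R with hθ
  have hθ0 : 0 ≤ θ := div_nonneg hδ hR.le
  have hsymm : ∀ l, (X l).IsSymm := fun l => by
    have := (hX l).1; rwa [Matrix.IsHermitian, conjTranspose_eq_transpose_of_trivial] at this
  set c := Real.exp (-(θ - θ ^ 2 * R / 2)) with hc
  have hpsd : (c • (1 : Matrix n n ℝ) - ∑ l, p l • exp (-θ • X l)).PosSemidef := by
    have h1 : (∑ l, p l • (1 - (θ - θ ^ 2 * R / 2) • X l - exp (-θ • X l))).PosSemidef :=
      posSemidef_sum _ fun l _ => (posSemidef_sub_exp_neg_smul (hX l) hθ0 (hbound l)).smul (hp l)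
    -- The mean being exactly `1` turns the linear bound into a scalar matrix, and `1 - a ≤ exp
    -- (-a)` then gives `c`.
    have h2 : ∑ l, p l • (1 - (θ - θ ^ 2 * R / 2) • X l - exp (-θ • X l))
        = (1 - (θ - θ ^ 2 * R / 2)) • (1 : Matrix n n ℝ) - ∑ l, p l • exp (-θ • X l) := by
      generalize θ - θ ^ 2 * R / 2 = a
      simp only [smul_sub, Finset.sum_sub_distrib, ← Finset.sum_smul, hp1,
        smul_comm (p _) a, ← Finset.smul_sum, hmean, sub_smul, one_smul]
    have h3 : 0 ≤ c - (1 - (θ - θ ^ 2 * R / 2)) := by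
      have := Real.add_one_le_exp (-(θ - θ ^ 2 * R / 2))
      rw [hc]; linarith
    have h4 := (PosSemidef.one (n := n) (R := ℝ)).smul h3
    rw [h2] at h1
    convert h4.add h1 using 1
    module
  have key := sum_prod_trace_exp_sum_le hp (fun l => (hsymm l).smul (-θ)) (Real.exp_pos _).le hpsd s
  -- Markov's inequality for the trace exponential: on a bad draw the trace is at least `exp
  -- (-θ(1-δ)s)`.
  have hmarkov : ∑ f : Fin s → ι with ∃ v : n → ℝ, v ⬝ᵥ v = 1 ∧
        v ⬝ᵥ ((∑ j, X (f j)) *ᵥ v) < (1 - δ) * s,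
        (∏ j, p (f j)) * Real.exp (-θ * ((1 - δ) * s))
      ≤ ∑ f : Fin s → ι, (∏ j, p (f j)) * (exp (∑ j, -θ • X (f j))).trace := by
    refine (Finset.sum_le_sum fun f hf => ?_).trans
      (Finset.sum_le_sum_of_subset_of_nonneg (Finset.filter_subset _ _) fun f _ _ => ?_)
    · obtain ⟨v, hv1, hv2⟩ := (Finset.mem_filter.1 hf).2
      refine mul_le_mul_of_nonneg_left ?_ (Finset.prod_nonneg fun j _ => hp _)
      have h5 : (∑ j, X (f j)).IsSymm := isSymm_sum _ fun j => hsymm (f j)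
      rw [← Finset.smul_sum]
      refine le_trans (Real.exp_le_exp.2 ?_) (exp_dotProduct_le_trace_exp (h5.smul (-θ)) hv1)
      rw [smul_mulVec, dotProduct_smul, smul_eq_mul]
      nlinarith
    · refine mul_nonneg (Finset.prod_nonneg fun j _ => hp _) (PosSemidef.trace_nonneg ?_)
      exact posSemidef_exp (isSymm_sum _ fun j => (hsymm (f j)).smul (-θ))
  rw [← Finset.sum_mul] at hmarkov
  have h6 := hmarkov.trans key
  rw [← le_div_iff₀ (Real.exp_pos _)] at h6
  refine h6.trans_eq ?_
  rw [← Real.exp_nat_mul, mul_comm, mul_div_assoc, ← Real.exp_sub]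
  congr 2
  rw [hθ]
  field_simp
  ring

end Chernoff

open Matrix

/-! ### Euclidean norms and regularised least squares. -/

section Norm

variable {ι κ κ' : Type*} [Fintype ι] [Fintype κ] [Fintype κ']

theorem norm2_nonneg (v : ι → ℝ) : 0 ≤ norm2 v := norm_nonneg _

theorem norm2_sq (v : ι → ℝ) : norm2 v ^ 2 = v ⬝ᵥ v := by
  rw [norm2, EuclideanSpace.norm_sq_eq]
  simp [dotProduct, sq]

theorem norm2_add_le (v w : ι → ℝ) : norm2 (v + w) ≤ norm2 v + norm2 w := by
  rw [norm2, WithLp.toLp_add]; exact norm_add_le _ _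

theorem norm2_sub_le (v w : ι → ℝ) : norm2 (v - w) ≤ norm2 v + norm2 w := by
  rw [norm2, WithLp.toLp_sub]; exact norm_sub_le _ _

theorem norm2_neg (v : ι → ℝ) : norm2 (-v) = norm2 v := by
  rw [norm2, WithLp.toLp_neg, norm_neg, norm2]

theorem norm2_smul (c : ℝ) (v : ι → ℝ) : norm2 (c • v) = |c| * norm2 v := by
  rw [norm2, WithLp.toLp_smul, norm_smul, norm2, Real.norm_eq_abs]

theorem norm2_eq_zero {v : ι → ℝ} : norm2 v = 0 ↔ v = 0 := by
  rw [norm2, norm_eq_zero, WithLp.toLp_eq_zero]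

open scoped Matrix.Norms.L2Operator in
theorem norm2_mulVec_le [DecidableEq ι] (X : Matrix κ ι ℝ) (v : ι → ℝ) :
    norm2 (X *ᵥ v) ≤ specNorm X * norm2 v :=
  l2_opNorm_mulVec X (WithLp.toLp 2 v)

/-- The regularised least squares problem `min ‖T z - b‖² + ‖V z‖²` has exactly one solution
when the kernels of `T` and `V` meet trivially. -/
theorem exists_unique_regularized_leastSquares (T : Matrix κ ι ℝ) (V : Matrix κ' ι ℝ) (b : κ → ℝ)
    (h : ∀ z, T *ᵥ z = 0 → V *ᵥ z = 0 → z = 0) :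
    ∃ z, ∀ z', (∀ y, norm2 (T *ᵥ z' - b) ^ 2 + norm2 (V *ᵥ z') ^ 2
      ≤ norm2 (T *ᵥ y - b) ^ 2 + norm2 (V *ᵥ y) ^ 2) ↔ z' = z := by
  classical
  set H := Tᵀ * T + Vᵀ * V with hH
  have hform : ∀ d, d ⬝ᵥ (H *ᵥ d) = norm2 (T *ᵥ d) ^ 2 + norm2 (V *ᵥ d) ^ 2 := fun d => by
    rw [hH, add_mulVec, dotProduct_add, norm2_sq, norm2_sq, ← mulVec_mulVec, ← mulVec_mulVec,
      dotProduct_mulVec, dotProduct_mulVec d, vecMul_transpose, vecMul_transpose]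
  have hker : ∀ d, norm2 (T *ᵥ d) ^ 2 + norm2 (V *ᵥ d) ^ 2 ≤ 0 → d = 0 := fun d hd => by
    have h1 : norm2 (T *ᵥ d) ^ 2 = 0 := by
      nlinarith [sq_nonneg (norm2 (T *ᵥ d)), sq_nonneg (norm2 (V *ᵥ d))]
    have h2 : norm2 (V *ᵥ d) ^ 2 = 0 := by
      nlinarith [sq_nonneg (norm2 (T *ᵥ d)), sq_nonneg (norm2 (V *ᵥ d))]
    exact h d (norm2_eq_zero.1 (pow_eq_zero_iff two_ne_zero |>.1 h1))
      (norm2_eq_zero.1 (pow_eq_zero_iff two_ne_zero |>.1 h2))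
  have hinj : Function.Injective (Matrix.mulVecLin H) := by
    rw [← LinearMap.ker_eq_bot, LinearMap.ker_eq_bot']
    intro d hd
    rw [mulVecLin_apply] at hd
    refine hker d ?_
    rw [← hform, hd, dotProduct_zero]
  obtain ⟨z, hz⟩ := LinearMap.injective_iff_surjective.1 hinj (Tᵀ *ᵥ b)
  rw [mulVecLin_apply] at hz
  -- As `z` solves the normal equations the cross terms cancel. The excess is a definite quadratic
  -- form in `d`, which yields minimality and uniqueness together.
  have hexpand : ∀ d, norm2 (T *ᵥ (z + d) - b) ^ 2 + norm2 (V *ᵥ (z + d)) ^ 2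
      = norm2 (T *ᵥ z - b) ^ 2 + norm2 (V *ᵥ z) ^ 2
        + (norm2 (T *ᵥ d) ^ 2 + norm2 (V *ᵥ d) ^ 2) := fun d => by
    have h1 : d ⬝ᵥ (H *ᵥ z) = d ⬝ᵥ (Tᵀ *ᵥ b) := by rw [hz]
    rw [hH, add_mulVec, dotProduct_add, ← mulVec_mulVec, ← mulVec_mulVec,
      dotProduct_mulVec, dotProduct_mulVec d Vᵀ, dotProduct_mulVec d Tᵀ b,
      vecMul_transpose, vecMul_transpose] at h1
    simp only [norm2_sq, mulVec_add, dotProduct_add, add_dotProduct, sub_dotProduct,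
      dotProduct_sub]
    rw [dotProduct_comm (T *ᵥ z) (T *ᵥ d), dotProduct_comm (V *ᵥ z) (V *ᵥ d),
      dotProduct_comm b (T *ᵥ d)]
    linarith
  refine ⟨z, fun z' => ⟨fun hmin => ?_, fun hzz y => ?_⟩⟩
  · have h1 := hmin z
    have h2 := hexpand (z' - z)
    rw [add_sub_cancel] at h2
    exact sub_eq_zero.1 (hker _ (by linarith))
  · have h2 := hexpand (y - z)
    rw [add_sub_cancel] at h2
    rw [hzz, h2]
    have := sq_nonneg (norm2 (T *ᵥ (y - z)))
    have := sq_nonneg (norm2 (V *ᵥ (y - z)))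
    linarith

end Norm

/-! ### Sampling and averaging matrices. -/

section Sampling

variable {n N s : ℕ} {G : Fin N → Finset (Fin n)} {p : Fin N → ℝ}

theorem groupMat_mulVec (l : Fin N) (v : Fin n → ℝ) (r : G l) :
    (groupMat G l *ᵥ v) r = v r := by
  simp [groupMat, mulVec, dotProduct]

theorem norm2_groupMat_mulVec_sq (l : Fin N) (v : Fin n → ℝ) :
    norm2 (groupMat G l *ᵥ v) ^ 2 = ∑ i ∈ G l, v i ^ 2 := by
  rw [norm2_sq, dotProduct, ← Finset.sum_coe_sort (G l)]
  exact Finset.sum_congr rfl fun r _ => by rw [groupMat_mulVec, sq]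

theorem norm2_weightMat_mul_sampleMat_mulVec_sq (hp : ∀ l, 0 < p l) (ω : Fin s → Fin N)
    (v : Fin n → ℝ) :
    norm2 ((weightMat G p ω * sampleMat G ω) *ᵥ v) ^ 2
      = ∑ j, (p (ω j))⁻¹ * norm2 (groupMat G (ω j) *ᵥ v) ^ 2 := by
  have h : ∀ r, ((weightMat G p ω * sampleMat G ω) *ᵥ v) r = (√(p (ω r.1)))⁻¹ * v r.2 := by
    intro r
    rw [← mulVec_mulVec, weightMat, mulVec_diagonal]
    congr 1
    exact groupMat_mulVec (ω r.1) v r.2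
  rw [norm2_sq, dotProduct, Fintype.sum_sigma]
  refine Finset.sum_congr rfl fun j _ => ?_
  rw [norm2_sq, dotProduct, Finset.mul_sum]
  refine Finset.sum_congr rfl fun r _ => ?_
  rw [h, groupMat_mulVec]
  have := Real.mul_self_sqrt (hp (ω j)).le
  rw [← this, mul_inv]
  simp only [Real.sqrt_mul_self (Real.sqrt_nonneg _)]
  ring

theorem norm2_redWeightMat_mul_redSampleMat_mulVec_sq (hp : ∀ l, 0 < p l) (ω : Fin s → Fin N)
    (z : Fin N → ℝ) :
    norm2 ((redWeightMat p ω * redSampleMat ω) *ᵥ z) ^ 2 = ∑ j, (p (ω j))⁻¹ * z (ω j) ^ 2 := by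
  rw [norm2_sq, dotProduct]
  refine Finset.sum_congr rfl fun j _ => ?_
  have h : ((redWeightMat p ω * redSampleMat ω) *ᵥ z) j = (√(p (ω j)))⁻¹ * z (ω j) := by
    rw [← mulVec_mulVec, redWeightMat, mulVec_diagonal]
    simp [redSampleMat, mulVec, dotProduct]
  rw [h]
  conv_rhs => rw [← Real.mul_self_sqrt (hp (ω j)).le]
  rw [mul_inv]
  ring

theorem avgMat_apply (l : Fin N) (i : Fin n) :
    avgMat G l i = if i ∈ G l then (√((G l).card : ℝ))⁻¹ else 0 := by
  have h : ((1 : G l → ℝ) ᵥ* groupMat G l) i = if i ∈ G l then 1 else 0 := by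
    simp only [vecMul, dotProduct, groupMat, of_apply, Pi.one_apply, one_mul]
    rw [Finset.sum_coe_sort (G l) fun r => if i = r then (1 : ℝ) else 0, Finset.sum_ite_eq]
  rw [avgMat, of_apply, h]
  split_ifs <;> simp

theorem avgMat_transpose_mulVec_apply (hG : IsPartition G) (z : Fin N → ℝ) {l : Fin N} {i : Fin n}
    (hi : i ∈ G l) : ((avgMat G)ᵀ *ᵥ z) i = (√((G l).card : ℝ))⁻¹ * z l := by
  simp only [mulVec, dotProduct, transpose_apply, avgMat_apply]
  rw [Finset.sum_eq_single l]
  · rw [if_pos hi]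
  · intro l' _ hl'
    rw [if_neg fun hi' => Finset.disjoint_left.1 (hG.disjoint l' l hl') hi' hi, zero_mul]
  · simp

/-- On group `l` the lifted vector takes `|N_l|` times the value `z l / √|N_l|`. -/
theorem norm2_groupMat_mulVec_avgMat_transpose_sq (hG : IsPartition G) (z : Fin N → ℝ)
    (l : Fin N) : norm2 (groupMat G l *ᵥ ((avgMat G)ᵀ *ᵥ z)) ^ 2 = z l ^ 2 := by
  have hc : (0 : ℝ) < (G l).card := by exact_mod_cast (hG.nonempty l).card_pos
  rw [norm2_groupMat_mulVec_sq,
    Finset.sum_congr rfl fun i hi => by rw [avgMat_transpose_mulVec_apply hG z hi],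
    Finset.sum_const, nsmul_eq_mul, mul_pow, inv_pow, Real.sq_sqrt hc.le]
  field_simp

theorem norm2_sampling_avgMat_transpose (hG : IsPartition G) (hp : ∀ l, 0 < p l)
    (ω : Fin s → Fin N) (z : Fin N → ℝ) :
    norm2 ((weightMat G p ω * sampleMat G ω) *ᵥ ((avgMat G)ᵀ *ᵥ z))
      = norm2 ((redWeightMat p ω * redSampleMat ω) *ᵥ z) := by
  refine (sq_eq_sq₀ (norm2_nonneg _) (norm2_nonneg _)).1 ?_
  rw [norm2_weightMat_mul_sampleMat_mulVec_sq hp, norm2_redWeightMat_mul_redSampleMat_mulVec_sq hp]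
  exact Finset.sum_congr rfl fun j _ => by rw [norm2_groupMat_mulVec_avgMat_transpose_sq hG]

theorem eq_zero_of_avgMat_transpose_mulVec_eq_zero (hG : IsPartition G) {z : Fin N → ℝ}
    (h : (avgMat G)ᵀ *ᵥ z = 0) : z = 0 := by
  funext l
  have := norm2_groupMat_mulVec_avgMat_transpose_sq hG z l
  rw [h, mulVec_zero, norm2_eq_zero.2 rfl] at this
  simpa using this.symm

end Sampling

/-! ### Graph Fourier basis and spectral filters. -/

section Spectral

variable {n k : ℕ} {L U : Matrix (Fin n) (Fin n) ℝ} {lam : Fin n → ℝ}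

theorem aeval_orthogonal_conj {L : Matrix (Fin n) (Fin n) ℝ} (hU : IsFourierBasis L U lam)
    (g : Polynomial ℝ) :
    Polynomial.aeval L g = U * diagonal (fun i => g.eval (lam i)) * Uᵀ := by
  have h2 : U * Uᵀ = 1 := mul_eq_one_comm.1 hU.orthonormal
  induction g using Polynomial.induction_on' with
  | add a b ha hb =>
    have : (diagonal fun i => (a + b).eval (lam i)) = diagonal (fun i => a.eval (lam i))
        + diagonal (fun i => b.eval (lam i)) := by
      rw [diagonal_add]; simp
    rw [map_add, ha, hb, this, Matrix.mul_add, Matrix.add_mul]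
  | monomial m c =>
    have hpow : L ^ m = U * diagonal (fun i => lam i ^ m) * Uᵀ := by
      induction m with
      | zero => simp [h2]
      | succ m ih =>
        rw [pow_succ, ih, hU.eigen]
        calc _ = U * diagonal (fun i => lam i ^ m) * (Uᵀ * U) * diagonal lam * Uᵀ := by
              simp only [Matrix.mul_assoc]
          _ = _ := by
              rw [hU.orthonormal, Matrix.mul_one, Matrix.mul_assoc U, diagonal_mul_diagonal]
              simp [pow_succ]
    rw [Polynomial.aeval_monomial, hpow]
    have : (diagonal fun i => (Polynomial.monomial m c).eval (lam i))
        = c • diagonal (fun i => lam i ^ m) := by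
      rw [← diagonal_smul]; congr 1; ext i; simp
    rw [this, Matrix.mul_smul, Matrix.smul_mul, ← Algebra.smul_def]

theorem IsFourierBasis.eigenvalue_nonneg (hU : IsFourierBasis L U lam) (hL : L.PosSemidef)
    (i : Fin n) : 0 ≤ lam i := by
  have h := hL.conjTranspose_mul_mul_same U
  have h2 : Uᴴ * L * U = diagonal lam := by
    rw [conjTranspose_eq_transpose_of_trivial, hU.eigen]
    calc _ = (Uᵀ * U) * diagonal lam * (Uᵀ * U) := by simp only [Matrix.mul_assoc]
      _ = _ := by rw [hU.orthonormal]; simp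
  rw [h2] at h
  exact posSemidef_diagonal_iff.1 h i

theorem firstCols_transpose_mul_self (hU : Uᵀ * U = 1) (hk : k ≤ n) :
    (firstCols U hk)ᵀ * firstCols U hk = 1 := by
  ext a b
  have h := congrFun (congrFun hU (Fin.castLE hk a)) (Fin.castLE hk b)
  rw [mul_apply] at h ⊢
  simp only [firstCols, transpose_apply, submatrix_apply, id] at h ⊢
  rw [h, one_apply, one_apply]
  simp [Fin.ext_iff]

theorem firstCols_mul_transpose (hk : k ≤ n) :
    firstCols U hk * (firstCols U hk)ᵀ
      = U * diagonal (fun i : Fin n => if (i : ℕ) < k then (1 : ℝ) else 0) * Uᵀ := by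
  ext a b
  rw [mul_apply, mul_apply]
  simp only [firstCols, transpose_apply, submatrix_apply, id, mul_diagonal]
  simp only [mul_ite, mul_one, mul_zero, ite_mul, zero_mul, ← Finset.sum_filter]
  refine Finset.sum_bij (fun i _ => Fin.castLE hk i) (fun i _ => by simp)
    (fun i _ j _ h => by simpa [Fin.ext_iff] using h)
    (fun i hi => ⟨⟨i, (Finset.mem_filter.1 hi).2⟩, Finset.mem_univ _, rfl⟩) (fun i _ => rfl)

theorem transpose_mulVec_firstCols_proj (hU : Uᵀ * U = 1) (hk : k ≤ n) (v : Fin n → ℝ)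
    (i : Fin n) : (Uᵀ *ᵥ ((firstCols U hk * (firstCols U hk)ᵀ) *ᵥ v)) i
      = if (i : ℕ) < k then (Uᵀ *ᵥ v) i else 0 := by
  rw [firstCols_mul_transpose, mulVec_mulVec]
  have : Uᵀ * (U * diagonal (fun i : Fin n => if (i : ℕ) < k then (1 : ℝ) else 0) * Uᵀ)
      = diagonal (fun i : Fin n => if (i : ℕ) < k then (1 : ℝ) else 0) * Uᵀ := by
    rw [← Matrix.mul_assoc, ← Matrix.mul_assoc, hU, Matrix.one_mul]
  rw [this, ← mulVec_mulVec, mulVec_diagonal]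
  split_ifs <;> simp

theorem firstCols_proj_mulVec (hU : Uᵀ * U = 1) (hk : k ≤ n) (η : Fin k → ℝ) :
    (firstCols U hk * (firstCols U hk)ᵀ) *ᵥ (firstCols U hk *ᵥ η) = firstCols U hk *ᵥ η := by
  rw [mulVec_mulVec, Matrix.mul_assoc, firstCols_transpose_mul_self hU, Matrix.mul_one]

/-- With `a i = g(λ_i)`, this matrix serves as a square root of `g(L)`, making the penalty a squared
norm. -/
theorem norm2_diagonal_sqrt_mulVec_sq {a : Fin n → ℝ} (ha : ∀ i, 0 ≤ a i) (v : Fin n → ℝ) :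
    norm2 ((diagonal (fun i => √(a i)) * Uᵀ) *ᵥ v) ^ 2 = ∑ i, a i * (Uᵀ *ᵥ v) i ^ 2 := by
  rw [norm2_sq, ← mulVec_mulVec, dotProduct]
  refine Finset.sum_congr rfl fun i _ => ?_
  rw [mulVec_diagonal]
  conv_rhs => rw [← Real.mul_self_sqrt (ha i)]
  ring

/-- Only frequencies present in `v` need the bound: `x` gets the constant `g(λ_k)`, an arbitrary
vector `g(λ_n)`. -/
theorem norm2_diagonal_sqrt_mulVec_le (hU : Uᵀ * U = 1) {a : Fin n → ℝ} (ha : ∀ i, 0 ≤ a i)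
    {c : ℝ} (hc : 0 ≤ c) {v : Fin n → ℝ} (h : ∀ i, (Uᵀ *ᵥ v) i ≠ 0 → a i ≤ c) :
    norm2 ((diagonal (fun i => √(a i)) * Uᵀ) *ᵥ v) ≤ √c * norm2 v := by
  refine (sq_le_sq₀ (norm2_nonneg _) (mul_nonneg (Real.sqrt_nonneg _) (norm2_nonneg _))).1 ?_
  rw [norm2_diagonal_sqrt_mulVec_sq ha, mul_pow, Real.sq_sqrt hc, norm2_sq,
    ← sum_sq_transpose_mulVec (mul_eq_one_comm.1 hU), Finset.mul_sum]
  refine Finset.sum_le_sum fun i _ => ?_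
  by_cases h0 : (Uᵀ *ᵥ v) i = 0
  · simp [h0]
  · exact mul_le_mul_of_nonneg_right (h i h0) (sq_nonneg _)

theorem sqrt_mul_norm2_le_norm2_diagonal_sqrt_mulVec (hU : Uᵀ * U = 1) {a : Fin n → ℝ}
    (ha : ∀ i, 0 ≤ a i) (hk : k ≤ n) {c : ℝ} (hc : 0 ≤ c) (h : ∀ i : Fin n, k ≤ (i : ℕ) → c ≤ a i)
    (v : Fin n → ℝ) :
    √c * norm2 ((1 - firstCols U hk * (firstCols U hk)ᵀ) *ᵥ v)
      ≤ norm2 ((diagonal (fun i => √(a i)) * Uᵀ) *ᵥ v) := by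
  refine (sq_le_sq₀ (mul_nonneg (Real.sqrt_nonneg _) (norm2_nonneg _)) (norm2_nonneg _)).1 ?_
  rw [norm2_diagonal_sqrt_mulVec_sq ha, mul_pow, Real.sq_sqrt hc, norm2_sq,
    ← sum_sq_transpose_mulVec (mul_eq_one_comm.1 hU), Finset.mul_sum]
  refine Finset.sum_le_sum fun i _ => ?_
  rw [sub_mulVec, one_mulVec, mulVec_sub, Pi.sub_apply, transpose_mulVec_firstCols_proj hU]
  split_ifs with hi
  · simpa using mul_nonneg (ha i) (sq_nonneg _)
  · rw [sub_zero]
    exact mul_le_mul_of_nonneg_right (h i (not_lt.1 hi)) (sq_nonneg _)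

end Spectral

open Matrix

/-! ### Deterministic stability of the reduced decoder. -/

section Stability

variable {n N s k : ℕ} {G : Fin N → Finset (Fin n)} {p : Fin N → ℝ}

/-- Stability of the reduced decoder for a draw whose reweighted sampling matrix satisfies the
lower restricted isometry property with constant `m` on the span of the first `k` columns. -/
theorem exists_unique_fastSolution_and_bounds (hle : k ≤ n) {iprev inext ilast : Fin n}
    (hprev : (iprev : ℕ) + 1 = k) (hnext : (inext : ℕ) = k) (hlast : (ilast : ℕ) + 1 = n)
    {L U : Matrix (Fin n) (Fin n) ℝ} {lam : Fin n → ℝ}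
    (hL : L.PosSemidef) (hU : IsFourierBasis L U lam) (hG : IsPartition G) (hp : ∀ l, 0 < p l)
    (ω : Fin s → Fin N) {m : ℝ} (hm : 0 < m)
    (hrip : ∀ η, m * norm2 (firstCols U hle *ᵥ η) ^ 2
      ≤ norm2 ((weightMat G p ω * sampleMat G ω) *ᵥ (firstCols U hle *ᵥ η)) ^ 2)
    {Mmax : ℝ} (hM0 : 0 < Mmax) (hM : specNorm (weightMat G p ω * sampleMat G ω) ≤ Mmax)
    {ε : ℝ} (hε : 0 ≤ ε) {x : Fin n → ℝ} (hx : x ∈ nearlyPiecewiseConst G (firstCols U hle) ε)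
    (noise : Fin s → ℝ) {γ : ℝ} (hγ : 0 < γ) {g : Polynomial ℝ}
    (hg0 : ∀ t ∈ Set.Icc 0 (lam ilast), 0 ≤ g.eval t)
    (hgm : MonotoneOn (fun t => g.eval t) (Set.Icc 0 (lam ilast)))
    (hgk : 0 < g.eval (lam inext)) :
    ∃ z : Fin N → ℝ,
      (∀ z' : Fin N → ℝ,
        IsFastSolution G L p ω γ g (redSampleMat ω *ᵥ (avgMat G *ᵥ x) + noise) z' ↔ z' = z) ∧
      norm2 ((firstCols U hle * (firstCols U hle)ᵀ) *ᵥ ((avgMat G)ᵀ *ᵥ z) - x) ≤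
        1 / √m *
          ((2 + Mmax / √(γ * g.eval (lam inext))) * norm2 (redWeightMat p ω *ᵥ noise)
            + (Mmax * √(g.eval (lam iprev) / g.eval (lam inext))
                + √(γ * g.eval (lam iprev))) * norm2 x
            + ε * (2 * Mmax
                + Mmax * √(g.eval (lam ilast) / g.eval (lam inext))
                + √(γ * g.eval (lam ilast))) * norm2 x) ∧
      norm2 ((1 - firstCols U hle * (firstCols U hle)ᵀ) *ᵥ ((avgMat G)ᵀ *ᵥ z)) ≤
        1 / √(γ * g.eval (lam inext)) * norm2 (redWeightMat p ω *ᵥ noise)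
          + √(g.eval (lam iprev) / g.eval (lam inext)) * norm2 x
          + ε * √(g.eval (lam ilast) / g.eval (lam inext)) * norm2 x := by
  obtain ⟨⟨η, hη⟩, hxε⟩ := hx
  have hlam : ∀ i, lam i ∈ Set.Icc 0 (lam ilast) := fun i =>
    ⟨hU.eigenvalue_nonneg hL i, hU.mono (Fin.le_def.2 (by omega))⟩
  have hmono : ∀ i j, i ≤ j → g.eval (lam i) ≤ g.eval (lam j) := fun i j hij =>
    hgm (hlam i) (hlam j) (hU.mono hij)
  have ha : ∀ i, 0 ≤ g.eval (lam i) := fun i => hg0 _ (hlam i)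
  have hgkn : ∀ i : Fin n, k ≤ (i : ℕ) → g.eval (lam inext) ≤ g.eval (lam i) :=
    fun i hi => hmono _ _ (Fin.le_def.2 (hnext.trans_le hi))
  -- With zero-based indices, `gk`, `gK`, `gn` are `g(λ_k)`, `g(λ_{k+1})`, `g(λ_n)`; the hypothesis
  -- `hgk` concerns `gK`.
  set gk := g.eval (lam iprev) with hgk_def
  set gK := g.eval (lam inext) with hgK_def
  set gn := g.eval (lam ilast) with hgn_def
  set W := diagonal (fun i => √(g.eval (lam i))) * Uᵀ with hW
  set Uk := firstCols U hle with hUk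
  set Q := weightMat G p ω * sampleMat G ω with hQ
  set T := redWeightMat p ω * redSampleMat ω with hT
  set A := avgMat G with hA
  set e := (Aᵀ * A - 1) *ᵥ x with he
  set a := norm2 (redWeightMat p ω *ᵥ noise) with ha_def
  have ha0 : 0 ≤ a := norm2_nonneg _
  have hTQ : ∀ z, norm2 (Q *ᵥ (Aᵀ *ᵥ z)) = norm2 (T *ᵥ z) := norm2_sampling_avgMat_transpose hG hp ω
  have hAx : Aᵀ *ᵥ (A *ᵥ x) = x + e := by
    rw [he, sub_mulVec, one_mulVec, mulVec_mulVec]; abel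
  have hQM : ∀ v, norm2 (Q *ᵥ v) ≤ Mmax * norm2 v := fun v =>
    (norm2_mulVec_le Q v).trans (mul_le_mul_of_nonneg_right hM (norm2_nonneg _))
  have hWK : ∀ v, √gK * norm2 ((1 - Uk * Ukᵀ) *ᵥ v) ≤ norm2 (W *ᵥ v) :=
    sqrt_mul_norm2_le_norm2_diagonal_sqrt_mulVec hU.orthonormal ha hle hgk.le hgkn
  have hWn : ∀ v, norm2 (W *ᵥ v) ≤ √gn * norm2 v := fun v =>
    norm2_diagonal_sqrt_mulVec_le hU.orthonormal ha (ha _) fun i _ =>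
      hmono _ _ (Fin.le_def.2 (by omega))
  have hWx : norm2 (W *ᵥ x) ≤ √gk * norm2 x := by
    refine norm2_diagonal_sqrt_mulVec_le hU.orthonormal ha (ha _) fun i hi => ?_
    refine hmono _ _ (Fin.le_def.2 ?_)
    rw [hη, ← firstCols_proj_mulVec hU.orthonormal,
      transpose_mulVec_firstCols_proj hU.orthonormal] at hi
    have : (i : ℕ) < k := by by_contra h; exact hi (if_neg h)
    omega
  have hobj : ∀ z, fastObjective G L p ω γ g (redSampleMat ω *ᵥ (A *ᵥ x) + noise) z
      = norm2 (T *ᵥ z - redWeightMat p ω *ᵥ (redSampleMat ω *ᵥ (A *ᵥ x) + noise)) ^ 2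
        + norm2 ((√γ • (W * Aᵀ)) *ᵥ z) ^ 2 := fun z => by
    rw [fastObjective, mulVec_sub, mulVec_mulVec, smul_mulVec, norm2_smul, mul_pow, sq_abs,
      Real.sq_sqrt hγ.le, ← mulVec_mulVec z W, hW, norm2_diagonal_sqrt_mulVec_sq ha,
      ← dotProduct_mulVec_orthogonal_conj, ← aeval_orthogonal_conj hU g, redLaplacian,
      Matrix.mul_assoc, ← mulVec_mulVec z (avgMat G), ← mulVec_mulVec z (Polynomial.aeval L g),
      dotProduct_mulVec z, ← mulVec_transpose]
  have hres : ∀ z, T *ᵥ z - redWeightMat p ω *ᵥ (redSampleMat ω *ᵥ (A *ᵥ x) + noise)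
      = T *ᵥ (z - A *ᵥ x) - redWeightMat p ω *ᵥ noise := fun z => by
    rw [mulVec_add, mulVec_sub, mulVec_mulVec _ (redWeightMat p ω)]; abel
  -- A vanishing penalty puts `Aᵀ *ᵥ z` in the span of `Uk`; a vanishing sampled part then makes it
  -- zero by the isometry, and `Aᵀ` is injective.
  have hker : ∀ z, T *ᵥ z = 0 → (√γ • (W * Aᵀ)) *ᵥ z = 0 → z = 0 := fun z hz1 hz2 => by
    rw [smul_mulVec, ← mulVec_mulVec] at hz2
    have h1 : W *ᵥ (Aᵀ *ᵥ z) = 0 := (smul_eq_zero.1 hz2).resolve_left (Real.sqrt_pos.2 hγ).ne'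
    have h2 := hWK (Aᵀ *ᵥ z)
    rw [h1, norm2_eq_zero.2 rfl] at h2
    have h3 : norm2 ((1 - Uk * Ukᵀ) *ᵥ (Aᵀ *ᵥ z)) = 0 :=
      le_antisymm (by nlinarith [Real.sqrt_pos.2 hgk]) (norm2_nonneg _)
    have h4 : Aᵀ *ᵥ z = Uk *ᵥ (Ukᵀ *ᵥ (Aᵀ *ᵥ z)) := by
      have := norm2_eq_zero.1 h3
      rw [sub_mulVec, one_mulVec, sub_eq_zero, ← mulVec_mulVec] at this
      exact this
    have h5 := hrip (Ukᵀ *ᵥ (Aᵀ *ᵥ z))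
    rw [← h4, hTQ, hz1, norm2_eq_zero.2 rfl] at h5
    refine eq_zero_of_avgMat_transpose_mulVec_eq_zero hG (norm2_eq_zero.1 ?_)
    refine pow_eq_zero_iff two_ne_zero |>.1 (le_antisymm ?_ (sq_nonneg _))
    by_contra! hcon
    have := mul_pos hm hcon
    simp only [ne_eq, OfNat.ofNat_ne_zero, not_false_eq_true, zero_pow] at h5
    linarith
  obtain ⟨z, hz⟩ := exists_unique_regularized_leastSquares T (√γ • (W * Aᵀ))
    (redWeightMat p ω *ᵥ (redSampleMat ω *ᵥ (A *ᵥ x) + noise)) hker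
  have hz_iff : ∀ z', IsFastSolution G L p ω γ g (redSampleMat ω *ᵥ (A *ᵥ x) + noise) z'
      ↔ z' = z := fun z' => by
    rw [← hz z', IsFastSolution]
    simp only [hobj]
  have hmin := (hz z).2 rfl (A *ᵥ x)
  rw [hres, hres, sub_self, mulVec_zero, zero_sub, norm2_neg, ← ha_def] at hmin
  have hV : ∀ y, norm2 ((√γ • (W * Aᵀ)) *ᵥ y) = √γ * norm2 (W *ᵥ (Aᵀ *ᵥ y)) := fun y => by
    rw [smul_mulVec, norm2_smul, abs_of_nonneg (Real.sqrt_nonneg _), mulVec_mulVec]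
  rw [hV, hV, hAx] at hmin
  set X := norm2 x with hX
  have hX0 : 0 ≤ X := norm2_nonneg _
  have heX : norm2 e ≤ ε * X := hxε
  set c := √γ * (√gk * X + √gn * (ε * X)) with hc
  have hc0 : 0 ≤ c := by positivity
  have hWe : √γ * norm2 (W *ᵥ (x + e)) ≤ c := by
    refine mul_le_mul_of_nonneg_left ?_ (Real.sqrt_nonneg _)
    rw [mulVec_add]
    exact (norm2_add_le _ _).trans (add_le_add hWx ((hWn e).trans
      (mul_le_mul_of_nonneg_left heX (Real.sqrt_nonneg _))))
  -- The competitor `A *ᵥ x` costs at most `a² + c² ≤ (a + c)²`, so residual and penalty root are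
  -- each at most `a + c`.
  have htot : norm2 (T *ᵥ (z - A *ᵥ x) - redWeightMat p ω *ᵥ noise) ^ 2
      + (√γ * norm2 (W *ᵥ (Aᵀ *ᵥ z))) ^ 2 ≤ (a + c) ^ 2 := by
    have h1 : (√γ * norm2 (W *ᵥ (x + e))) ^ 2 ≤ c ^ 2 :=
      pow_le_pow_left₀ (mul_nonneg (Real.sqrt_nonneg _) (norm2_nonneg _)) hWe 2
    nlinarith [mul_nonneg ha0 hc0]
  have hr : norm2 (T *ᵥ (z - A *ᵥ x) - redWeightMat p ω *ᵥ noise) ≤ a + c :=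
    abs_le_of_sq_le_sq' ((le_add_of_nonneg_right (sq_nonneg _)).trans htot)
      (add_nonneg ha0 hc0) |>.2
  have hw : √γ * norm2 (W *ᵥ (Aᵀ *ᵥ z)) ≤ a + c :=
    abs_le_of_sq_le_sq' ((le_add_of_nonneg_left (sq_nonneg _)).trans htot)
      (add_nonneg ha0 hc0) |>.2
  set β := (1 - Uk * Ukᵀ) *ᵥ (Aᵀ *ᵥ z) with hβ
  have hgKpos : 0 < √gK := Real.sqrt_pos.2 hgk
  have hγpos : 0 < √γ := Real.sqrt_pos.2 hγ
  set B := 1 / √(γ * gK) * a + √(gk / gK) * X + ε * √(gn / gK) * X with hB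
  have hBeq : B = (a + c) / (√γ * √gK) := by
    rw [hB, hc, Real.sqrt_mul hγ.le, Real.sqrt_div (show 0 ≤ gk from ha _),
      Real.sqrt_div (show 0 ≤ gn from ha _)]
    field_simp
    ring
  have hβB : norm2 β ≤ B := by
    rw [hBeq, le_div_iff₀ (mul_pos hγpos hgKpos)]
    calc norm2 β * (√γ * √gK) = √γ * (√gK * norm2 β) := by ring
      _ ≤ √γ * norm2 (W *ᵥ (Aᵀ *ᵥ z)) := mul_le_mul_of_nonneg_left (hWK _) hγpos.le
      _ ≤ a + c := hw
  refine ⟨z, hz_iff, ?_, hβB⟩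
  set α := (Uk * Ukᵀ) *ᵥ (Aᵀ *ᵥ z) with hα
  have hspan : α - x = Uk *ᵥ (Ukᵀ *ᵥ (Aᵀ *ᵥ z) - η) := by
    rw [mulVec_sub, ← hη, hα, ← mulVec_mulVec]
  have hdecomp : α - x = Aᵀ *ᵥ (z - A *ᵥ x) + e - β := by
    rw [mulVec_sub, hAx, hβ, hα, sub_mulVec, one_mulVec]; abel
  have hlow : √m * norm2 (α - x) ≤ norm2 (Q *ᵥ (α - x)) := by
    refine (sq_le_sq₀ (mul_nonneg (Real.sqrt_nonneg _) (norm2_nonneg _)) (norm2_nonneg _)).1 ?_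
    rw [mul_pow, Real.sq_sqrt hm.le, hspan]
    exact hrip _
  have hTz : norm2 (T *ᵥ (z - A *ᵥ x)) ≤ (a + c) + a := by
    have := norm2_add_le (T *ᵥ (z - A *ᵥ x) - redWeightMat p ω *ᵥ noise) (redWeightMat p ω *ᵥ noise)
    rw [sub_add_cancel] at this
    linarith
  have hup : norm2 (Q *ᵥ (α - x)) ≤ (a + c) + a + Mmax * (ε * X) + Mmax * B := by
    rw [hdecomp, mulVec_sub, mulVec_add]
    refine (norm2_sub_le _ _).trans (add_le_add ((norm2_add_le _ _).trans
      (add_le_add ?_ ?_)) ?_)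
    · rw [hTQ]; exact hTz
    · exact (hQM e).trans (mul_le_mul_of_nonneg_left heX hM0.le)
    · exact (hQM β).trans (mul_le_mul_of_nonneg_left hβB hM0.le)
  rw [one_div, ← div_eq_inv_mul, le_div_iff₀ (Real.sqrt_pos.2 hm), mul_comm]
  refine (hlow.trans hup).trans ?_
  -- The argument gives `ε * Mmax` where the claim allows `2 * ε * Mmax`.
  have hslack : 0 ≤ Mmax * (ε * X) := by positivity
  rw [hB, hc, Real.sqrt_mul hγ.le gk, Real.sqrt_mul hγ.le gn, one_div, div_eq_mul_inv Mmax]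
  linarith

end Stability

/-! ### Restricted isometry for random draws. -/

section Probability

variable {n N s k : ℕ} {G : Fin N → Finset (Fin n)} {p : Fin N → ℝ}

theorem measureReal_draw_mem [DecidableEq (Fin s → Fin N)] {Ω : Type*} [MeasurableSpace Ω]
    {μ : Measure Ω} [IsProbabilityMeasure μ] {ω : Fin s → Ω → Fin N} (hωm : ∀ j, Measurable (ω j))
    (hωi : iIndepFun ω μ) (hωp : ∀ j l, μ.real {w | ω j w = l} = p l)
    (B : Finset (Fin s → Fin N)) :
    μ.real {w | (fun j => ω j w) ∈ B} = ∑ f ∈ B, ∏ j, p (f j) := by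
  have hset : {w | (fun j => ω j w) ∈ B} = ⋃ f ∈ B, {w | (fun j => ω j w) = f} := by
    ext w; simp
  have hmeas : ∀ f, MeasurableSet {w | (fun j => ω j w) = f} := fun f =>
    (measurable_pi_lambda _ hωm) (measurableSet_singleton f)
  rw [hset, measureReal_biUnion_finset]
  · refine Finset.sum_congr rfl fun f _ => ?_
    have h := hωi.measure_inter_preimage_eq_mul Finset.univ (sets := fun j => {f j})
      fun j _ => measurableSet_singleton _
    have h2 : {w | (fun j => ω j w) = f} = ⋂ j ∈ Finset.univ, ω j ⁻¹' {f j} := by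
      ext w; simp [funext_iff]
    rw [h2, Measure.real, h, ENNReal.toReal_prod]
    exact Finset.prod_congr rfl fun j _ => hωp j (f j)
  · intro f _ f' _ hff
    exact Set.disjoint_left.2 fun w hw hw' => hff (hw.symm.trans hw')
  · exact fun f _ => hmeas f

theorem norm2_groupMat_mul_mulVec_sq_le_coherence (hp : ∀ l, 0 < p l)
    (Uk : Matrix (Fin n) (Fin k) ℝ) (l : Fin N) (v : Fin k → ℝ) :
    (p l)⁻¹ * norm2 ((groupMat G l * Uk) *ᵥ v) ^ 2 ≤ coherence G p Uk ^ 2 * (v ⬝ᵥ v) := by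
  have h1 : (√(p l))⁻¹ * specNorm (groupMat G l * Uk) ≤ coherence G p Uk :=
    le_ciSup (f := fun l => (√(p l))⁻¹ * specNorm (groupMat G l * Uk))
      (Set.finite_range _).bddAbove l
  have h2 : (√(p l))⁻¹ * norm2 ((groupMat G l * Uk) *ᵥ v) ≤ coherence G p Uk * norm2 v :=
    calc _ ≤ (√(p l))⁻¹ * (specNorm (groupMat G l * Uk) * norm2 v) :=
          mul_le_mul_of_nonneg_left (norm2_mulVec_le _ v) (inv_nonneg.2 (Real.sqrt_nonneg _))
      _ = (√(p l))⁻¹ * specNorm (groupMat G l * Uk) * norm2 v := by ring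
      _ ≤ _ := mul_le_mul_of_nonneg_right h1 (norm2_nonneg _)
  have h3 := pow_le_pow_left₀ (mul_nonneg (inv_nonneg.2 (Real.sqrt_nonneg _)) (norm2_nonneg _)) h2 2
  rwa [mul_pow, mul_pow, inv_pow, Real.sq_sqrt (hp l).le, norm2_sq v] at h3

theorem sum_transpose_groupMat_mul_groupMat (hG : IsPartition G) :
    ∑ l, (groupMat G l)ᵀ * groupMat G l = 1 := by
  ext a b
  have h : ∀ l, ((groupMat G l)ᵀ * groupMat G l) a b
      = if a ∈ G l then (1 : Matrix (Fin n) (Fin n) ℝ) a b else 0 := fun l => by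
    simp only [mul_apply, transpose_apply, groupMat, of_apply, ite_mul, one_mul, zero_mul]
    rw [Finset.sum_coe_sort (G l) fun r => if a = r then if b = r then (1 : ℝ) else 0 else 0,
      Finset.sum_ite_eq]
    simp [one_apply, eq_comm]
  obtain ⟨l, hl⟩ := hG.cover a
  simp only [Matrix.sum_apply, h]
  rw [Finset.sum_eq_single l, if_pos hl]
  · intro l' _ hl'
    exact if_neg fun h' => Finset.disjoint_left.1 (hG.disjoint l' l hl') h' hl
  · simp

/-- With high probability the reweighted sampling matrix satisfies the lower restricted isometry
property on the span of `Uk`. -/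
theorem le_measureReal_lower_restricted_isometry (hk : 1 ≤ k) (hG : IsPartition G)
    (hp : ∀ l, 0 < p l) (hp1 : ∑ l, p l = 1) {Uk : Matrix (Fin n) (Fin k) ℝ} (hUk : Ukᵀ * Uk = 1)
    {Ω : Type*} [MeasurableSpace Ω] {μ : Measure Ω} [IsProbabilityMeasure μ]
    {ω : Fin s → Ω → Fin N} (hωm : ∀ j, Measurable (ω j)) (hωi : iIndepFun ω μ)
    (hωp : ∀ j l, μ.real {w | ω j w = l} = p l)
    {δ ξ : ℝ} (hδ : δ ∈ Set.Ioo (0 : ℝ) 1) (hξ : ξ ∈ Set.Ioo (0 : ℝ) 1)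
    (hs : 3 / δ ^ 2 * coherence G p Uk ^ 2 * Real.log (2 * (k : ℝ) / ξ) ≤ (s : ℝ)) :
    0 < s ∧ 1 - ξ ≤ μ.real {w | ∀ η, s * (1 - δ) * norm2 (Uk *ᵥ η) ^ 2
      ≤ norm2 ((weightMat G p (fun j => ω j w) * sampleMat G (fun j => ω j w))
        *ᵥ (Uk *ᵥ η)) ^ 2} := by
  classical
  have : Nonempty (Fin k) := ⟨⟨0, hk⟩⟩
  have hk0 : (0 : ℝ) < k := by exact_mod_cast hk
  set X : Fin N → Matrix (Fin k) (Fin k) ℝ :=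
    fun l => (p l)⁻¹ • ((groupMat G l * Uk)ᵀ * (groupMat G l * Uk)) with hX_def
  set R := coherence G p Uk ^ 2 with hR_def
  have hXv : ∀ l v, v ⬝ᵥ (X l *ᵥ v) = (p l)⁻¹ * norm2 ((groupMat G l * Uk) *ᵥ v) ^ 2 := fun l v => by
    rw [hX_def]
    simp only
    rw [smul_mulVec, dotProduct_smul, smul_eq_mul, norm2_sq, ← mulVec_mulVec, dotProduct_mulVec,
      vecMul_transpose]
  have hX : ∀ l, (X l).PosSemidef := fun l => by
    refine PosSemidef.smul ?_ (inv_nonneg.2 (hp l).le)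
    rw [← conjTranspose_eq_transpose_of_trivial]
    exact posSemidef_conjTranspose_mul_self _
  have hmean : ∑ l, p l • X l = 1 := by
    have h1 : ∀ l, p l • X l = Ukᵀ * ((groupMat G l)ᵀ * groupMat G l) * Uk := fun l => by
      rw [hX_def]
      simp only
      rw [smul_smul, mul_inv_cancel₀ (hp l).ne', one_smul, transpose_mul]
      simp only [Matrix.mul_assoc]
    simp only [h1]
    rw [← Matrix.sum_mul, ← Matrix.mul_sum, sum_transpose_groupMat_mul_groupMat hG,
      Matrix.mul_one, hUk]
  have hbound : ∀ l v, v ⬝ᵥ (X l *ᵥ v) ≤ R * (v ⬝ᵥ v) := fun l v => by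
    rw [hXv]; exact norm2_groupMat_mul_mulVec_sq_le_coherence hp Uk l v
  -- The forms of the `X l` at a unit vector average to `1` and are at most `R`, so in fact `1 ≤ R`.
  -- This positivity also forces `0 < s`.
  have hR : 0 < R := by
    set v : Fin k → ℝ := Pi.single ⟨0, hk⟩ 1
    have hv : v ⬝ᵥ v = 1 := by simp [v]
    have h1 : v ⬝ᵥ ((∑ l, p l • X l) *ᵥ v) = 1 := by rw [hmean, one_mulVec, hv]
    rw [sum_mulVec, dotProduct_sum] at h1
    have h2 : ∑ l, v ⬝ᵥ ((p l • X l) *ᵥ v) ≤ ∑ l, p l * R := Finset.sum_le_sum fun l _ => by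
      rw [smul_mulVec, dotProduct_smul, smul_eq_mul]
      have := hbound l v
      rw [hv, mul_one] at this
      exact mul_le_mul_of_nonneg_left this (hp l).le
    rw [← Finset.sum_mul, hp1] at h2
    linarith
  have hlog : 0 < Real.log (2 * k / ξ) := by
    refine Real.log_pos ?_
    rw [one_lt_div hξ.1]
    have : (1 : ℝ) ≤ k := by exact_mod_cast hk
    linarith [hξ.2]
  have hδ2 : 0 < δ ^ 2 := pow_pos hδ.1 2
  have hs0 : (0 : ℝ) < s := lt_of_lt_of_le (by positivity) hs
  refine ⟨by exact_mod_cast hs0, ?_⟩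
  set B : Finset (Fin s → Fin N) := {f | ∃ v : Fin k → ℝ, v ⬝ᵥ v = 1 ∧
    v ⬝ᵥ ((∑ j, X (f j)) *ᵥ v) < (1 - δ) * s} with hB
  have hch : ∑ f ∈ B, ∏ j, p (f j) ≤ ξ := by
    refine (matrix_chernoff_lower_tail (fun l => (hp l).le) hp1 hX hmean hR hbound hδ.1.le s).trans ?_
    rw [Fintype.card_fin]
    -- For this one-sided tail the constant `2` in place of `3` would suffice, and the failure
    -- probability is even at most `ξ / 2`.
    have h1 : Real.log (2 * k / ξ) ≤ s * δ ^ 2 / (2 * R) := by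
      rw [le_div_iff₀ (by positivity)]
      have h2 := mul_le_mul_of_nonneg_right hs hδ2.le
      have h3 : 3 / δ ^ 2 * R * Real.log (2 * k / ξ) * δ ^ 2 = 3 * R * Real.log (2 * k / ξ) := by
        have hδ0 := hδ.1.ne'
        field_simp
      have := mul_pos hR hlog
      rw [h3] at h2
      linarith
    have h4 : Real.exp (-(s * δ ^ 2 / (2 * R))) ≤ ξ / (2 * k) := by
      refine (Real.exp_le_exp.2 (neg_le_neg h1)).trans_eq ?_
      rw [Real.exp_neg, Real.exp_log (div_pos (by positivity) hξ.1), inv_div]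
    calc (k : ℝ) * Real.exp (-(s * δ ^ 2 / (2 * R))) ≤ k * (ξ / (2 * k)) := by gcongr
      _ = ξ / 2 := by field_simp
      _ ≤ ξ := by linarith [hξ.1]
  have hdraw := measureReal_draw_mem hωm hωi hωp B
  have hmeas : MeasurableSet {w | (fun j => ω j w) ∈ B} :=
    (measurable_pi_lambda _ hωm) (B.measurableSet)
  have hcompl := probReal_compl_eq_one_sub (μ := μ) hmeas
  -- The complement of the bad draws is measurable and lies inside the target event, whose own
  -- measurability is not needed.
  refine le_trans (b := μ.real {w | (fun j => ω j w) ∈ B}ᶜ) (by rw [hcompl, hdraw]; linarith) ?_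
  refine measureReal_mono fun w hw η => ?_
  have hgood : ∀ v : Fin k → ℝ, v ⬝ᵥ v = 1 →
      (1 - δ) * s ≤ v ⬝ᵥ ((∑ j, X (ω j w)) *ᵥ v) := fun v hv => by
    by_contra! hcon
    exact hw (Finset.mem_filter.2 ⟨Finset.mem_univ _, v, hv, hcon⟩)
  have hq : ∀ v, v ⬝ᵥ ((∑ j, X (ω j w)) *ᵥ v) = norm2 ((weightMat G p (fun j => ω j w)
      * sampleMat G (fun j => ω j w)) *ᵥ (Uk *ᵥ v)) ^ 2 := fun v => by
    rw [norm2_weightMat_mul_sampleMat_mulVec_sq hp, sum_mulVec, dotProduct_sum]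
    exact Finset.sum_congr rfl fun j _ => by rw [hXv, mulVec_mulVec]
  have hUη : norm2 (Uk *ᵥ η) ^ 2 = norm2 η ^ 2 := by
    rw [norm2_sq, norm2_sq, dotProduct_mulVec, ← mulVec_transpose, mulVec_mulVec, hUk, one_mulVec]
  rw [hUη]
  by_cases h0 : norm2 η = 0
  · rw [h0]; simpa using sq_nonneg _
  · have hunit : ((norm2 η)⁻¹ • η) ⬝ᵥ ((norm2 η)⁻¹ • η) = 1 := by
      rw [smul_dotProduct, dotProduct_smul, ← norm2_sq, smul_eq_mul, smul_eq_mul]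
      field_simp
    have h1 := hgood _ hunit
    rw [hq, mulVec_smul, mulVec_smul, norm2_smul, mul_pow, sq_abs, inv_pow,
      ← div_eq_inv_mul, le_div_iff₀ (pow_pos (lt_of_le_of_ne (norm2_nonneg _) (Ne.symm h0)) 2)] at h1
    linarith

end Probability
end GroupSampling

theorem theorem2
    {n N s k : ℕ} (hk : 1 ≤ k) (hkn : k < n)
    (L U : Matrix (Fin n) (Fin n) ℝ) (lam : Fin n → ℝ)
    (hL : L.PosSemidef) (hU : IsFourierBasis L U lam)
    (G : Fin N → Finset (Fin n)) (hG : IsPartition G)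
    (p : Fin N → ℝ) (hp : ∀ l, 0 < p l) (hp1 : ∑ l, p l = 1)
    {Ω : Type*} [MeasurableSpace Ω] (μ : Measure Ω) [IsProbabilityMeasure μ]
    (ω : Fin s → Ω → Fin N) (hωm : ∀ j, Measurable (ω j)) (hωi : iIndepFun ω μ)
    (hωp : ∀ j l, μ.real {w | ω j w = l} = p l)
    (δ ξ : ℝ) (hδ : δ ∈ Set.Ioo (0 : ℝ) 1) (hξ : ξ ∈ Set.Ioo (0 : ℝ) 1)
    (hs : 3 / δ ^ 2 * coherence G p (firstCols U hkn.le) ^ 2 * Real.log (2 * (k : ℝ) / ξ)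
      ≤ (s : ℝ)) :
    1 - ξ ≤ μ.real {w |
      ∀ Mmax : ℝ, 0 < Mmax →
      specNorm (weightMat G p (fun j => ω j w) * sampleMat G (fun j => ω j w)) ≤ Mmax →
      ∀ ε : ℝ, 0 ≤ ε →
      ∀ x ∈ nearlyPiecewiseConst G (firstCols U hkn.le) ε,
      ∀ (noise : Fin s → ℝ) (γ : ℝ), 0 < γ →
      ∀ g : Polynomial ℝ,
      (∀ t ∈ Set.Icc 0 (lam ⟨n - 1, by omega⟩), 0 ≤ g.eval t) →
      MonotoneOn (fun t => g.eval t) (Set.Icc 0 (lam ⟨n - 1, by omega⟩)) →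
      0 < g.eval (lam ⟨k, hkn⟩) →
      ∃ z : Fin N → ℝ,
        (∀ z' : Fin N → ℝ,
          IsFastSolution G L p (fun j => ω j w) γ g
            (redSampleMat (fun j => ω j w) *ᵥ (avgMat G *ᵥ x) + noise) z' ↔ z' = z) ∧
        norm2 ((firstCols U hkn.le * (firstCols U hkn.le)ᵀ) *ᵥ ((avgMat G)ᵀ *ᵥ z) - x) ≤
          1 / √((s : ℝ) * (1 - δ)) *
            ((2 + Mmax / √(γ * g.eval (lam ⟨k, hkn⟩)))
                * norm2 (redWeightMat p (fun j => ω j w) *ᵥ noise)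
              + (Mmax * √(g.eval (lam ⟨k - 1, by omega⟩) / g.eval (lam ⟨k, hkn⟩))
                  + √(γ * g.eval (lam ⟨k - 1, by omega⟩))) * norm2 x
              + ε * (2 * Mmax
                  + Mmax * √(g.eval (lam ⟨n - 1, by omega⟩) / g.eval (lam ⟨k, hkn⟩))
                  + √(γ * g.eval (lam ⟨n - 1, by omega⟩))) * norm2 x) ∧
        norm2 ((1 - firstCols U hkn.le * (firstCols U hkn.le)ᵀ) *ᵥ ((avgMat G)ᵀ *ᵥ z)) ≤
          1 / √(γ * g.eval (lam ⟨k, hkn⟩)) * norm2 (redWeightMat p (fun j => ω j w) *ᵥ noise)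
            + √(g.eval (lam ⟨k - 1, by omega⟩) / g.eval (lam ⟨k, hkn⟩)) * norm2 x
            + ε * √(g.eval (lam ⟨n - 1, by omega⟩) / g.eval (lam ⟨k, hkn⟩)) * norm2 x} := by
  obtain ⟨hs0, hprob⟩ := le_measureReal_lower_restricted_isometry hk hG hp hp1
    (firstCols_transpose_mul_self hU.orthonormal hkn.le) hωm hωi hωp hδ hξ hs
  -- The isometry event involves none of the quantified data, so a single event serves every choice
  -- of them.
  refine hprob.trans (measureReal_mono fun w hw => ?_)
  have hm : 0 < (s : ℝ) * (1 - δ) :=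
    mul_pos (Nat.cast_pos.2 hs0) (sub_pos.2 hδ.2)
  intro Mmax hM0 hM ε hε x hx noise γ hγ g hg0 hgm hgk
  exact exists_unique_fastSolution_and_bounds hkn.le (Nat.sub_add_cancel hk) rfl
    (Nat.sub_add_cancel (Nat.one_le_of_lt hkn)) hL hU hG hp (fun j => ω j w) hm hw hM0 hM hε hx
    noise hγ hg0 hgm hgk
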